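/- Let $a,b,c,d\in\mathbb R$, $\varepsilon>0$. Consider on $(0,1)\times(0,\infty)$ the coupled wave–heat system $$u_{tt}=u_{xx},\quad u(0,t)=0,\quad u_x(1,t)=-a\,u_t(1,t)+b\,p(0,t),$$ $$\varepsilon p_t=p_{xx},\quad p_x(0,t)=c\,p(0,t),\quad p_x(1,t)=d\,u(1,t),$$ with $(u,u_t,p)(0)=(u_0,u_1,p_0)$; the reduced system $$\bar u_{tt}=\bar u_{xx},\quad \bar u(0,t)=0,\quad \bar u_x(1,t)=-a\,\bar u_t(1,t)+\tfrac{bd}{c}\bar u(1,t),\quad (\bar u,\bar u_t)(0)=(\bar u_0,\bar u_1);$$ and the boundary-layer system, in the time variable $\tau=t/\varepsilon$, $$\bar p_\tau=\bar p_{xx},\quad \bar p_x(0,\tau)=c\,\bar p(0,\tau),\quad \bar p_x(1,\tau)=0,\quad \bar p(0)=\bar p_0 .$$ Put $\eta=\frac{\sqrt3+1}{\sqrt3-1}$, $\mu^*=\ln\frac{|1+a|}{\sqrt2\,|1-a|}$, $F(\mu)=2\sinh\mu+10\cosh\mu$. Suppose that $0<\mu\le\mu^*$ and (i) $a\in[\eta^{-1},\eta]\setminus\{1\}$;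 (ii) $|bd/c|\le 1$; (iii) $c\ge\pi^2/8$; (iv) $1+2(\sinh\mu+2\cosh\mu)b^2\le c$; (v) $|d|\le 2\sqrt{\mu e^{-\mu}}$; and moreover (1) $c\ge\pi^2/4$; (2) $\frac{\pi^2+2}{4}+F(\mu)b^2\le c$; (3) $|d|\le\sqrt{\mu e^{-\mu}}$. Then there is $\varepsilon^*>0$ such that for every $M$ there is a constant $C$ with the following property. Let $\varepsilon\in(0,\varepsilon^*)$, $u_0,\bar u_0,\bar p_0\in H^1(0,1)$, $u_1,\bar u_1,p_0\in L^2(0,1)$ with $u_0(0)=\bar u_0(0)=0$ and $$\|u_0-\bar u_0\|_{H^1}+\|u_1-\bar u_1\|_{L^2}+\Big\|p_0-\bar p_0-d\,\tfrac{1+cx}{c}\,u_0(1)\Big\|_{L^2}\le M\varepsilon^{3/2},$$ $$\|\bar p_0\|_{H^1}\le M\varepsilon,\qquad \|\bar u_0\|_{H^1}+\|\bar u_1\|_{L^2}\le M\varepsilon^{3/2}.$$ Then the coupled system has a unique mild solution $(u,u_t,p)\in C([0,\infty);H^1\times L^2\times L^2)$, the reduced system has a unique mild solution $\bar u\in C([0,\infty);H^1)\cap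 C^1([0,\infty);L^2)$, the boundary-layer system has a unique mild solution $\bar p$, which belongs to $C([0,\infty);H^1)$, and for all $t\ge0$ $$\|u(t)-\bar u(t)\|_{H^1}+\|u_t(t)-\bar u_t(t)\|_{L^2}\le C e^{-\mu t/8}\,\varepsilon^{3/2},$$ $$\Big\|p(t)-\bar p(t/\varepsilon)-\tfrac{1+cx}{c}\,d\,\bar u(1,t)\Big\|_{L^2}\le C e^{-\mu t/8}\,\varepsilon .$$ -/

import Mathlib

open MeasureTheory Set
open scoped ContDiff

noncomputable section

namespace HeatWave

/-! ### The spaces `L²(0,1)` and `H¹(0,1)` -/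

/-- Lebesgue measure on the interval `(0,1)`. -/
abbrev vol01 : Measure ℝ := volume.restrict (Ioo (0 : ℝ) 1)

/-- The real Hilbert space `L²(0,1)`. -/
abbrev L2 : Type := Lp ℝ 2 vol01

/-- Test functions on `(0,1)`: smooth, with compact support contained in `(0,1)`. -/
def IsTest (φ : ℝ → ℝ) : Prop :=
  ContDiff ℝ ∞ φ ∧ HasCompactSupport φ ∧ tsupport φ ⊆ Ioo (0 : ℝ) 1

/-- `g ∈ L²(0,1)` is the weak (distributional) derivative of `f ∈ L²(0,1)` on `(0,1)`. -/
def HasWeakDeriv (f g : L2) : Prop :=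
  ∀ φ : ℝ → ℝ, IsTest φ →
    ∫ x in Ioo (0 : ℝ) 1, f x * deriv φ x = -∫ x in Ioo (0 : ℝ) 1, g x * φ x

theorem memLp_of_continuous {φ : ℝ → ℝ} (hφ : Continuous φ) : MemLp φ 2 vol01 := by
  have h : MemLp φ 2 (volume.restrict (Icc (0 : ℝ) 1)) := by
    obtain ⟨C, hC⟩ := isCompact_Icc.exists_bound_of_continuousOn (s := Icc (0 : ℝ) 1)
      hφ.continuousOn
    refine MemLp.of_bound hφ.aestronglyMeasurable C ?_
    exact (ae_restrict_iff' measurableSet_Icc).2 (Filter.Eventually.of_forall hC)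
  exact h.mono_measure (Measure.restrict_mono Ioo_subset_Icc_self le_rfl)

theorem inner_toLp (f : L2) {φ : ℝ → ℝ} (hφ : MemLp φ 2 vol01) :
    inner ℝ (hφ.toLp φ) f = ∫ x in Ioo (0 : ℝ) 1, f x * φ x := by
  rw [L2.inner_def]
  refine integral_congr_ae ?_
  filter_upwards [hφ.coeFn_toLp] with x hx
  simp [hx]

theorem IsTest.continuous {φ : ℝ → ℝ} (h : IsTest φ) : Continuous φ := h.1.continuous

theorem IsTest.continuous_deriv {φ : ℝ → ℝ} (h : IsTest φ) : Continuous (deriv φ) :=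
  h.1.continuous_deriv (by simp)

theorem hasWeakDeriv_iff (f g : L2) : HasWeakDeriv f g ↔ ∀ (φ : ℝ → ℝ) (h : IsTest φ),
    inner ℝ ((memLp_of_continuous h.continuous_deriv).toLp (deriv φ)) f
      + inner ℝ ((memLp_of_continuous h.continuous).toLp φ) g = 0 := by
  refine forall₂_congr fun φ h => ?_
  rw [inner_toLp, inner_toLp]
  exact eq_neg_iff_add_eq_zero

/-- The Sobolev space `H¹(0,1)`: pairs `(f, f')` of elements of `L²(0,1)` such that `f'` is the
weak derivative of `f`, with the norm `(‖f‖² + ‖f'‖²)^{1/2}`. -/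
def H1Submodule : Submodule ℝ (WithLp 2 (L2 × L2)) where
  carrier := {w | HasWeakDeriv w.fst w.snd}
  add_mem' := by
    intro v w hv hw
    simp only [mem_ofPred_eq, hasWeakDeriv_iff] at hv hw ⊢
    intro φ h
    have h1 := hv φ h
    have h2 := hw φ h
    simp only [WithLp.add_fst, WithLp.add_snd, inner_add_right]
    linarith
  zero_mem' := by
    simp [hasWeakDeriv_iff]
  smul_mem' := by
    intro r w hw
    simp only [mem_ofPred_eq, hasWeakDeriv_iff] at hw ⊢
    intro φ h
    have h2 := hw φ h
    simp only [WithLp.smul_fst, WithLp.smul_snd, inner_smul_right]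
    rw [← mul_add, h2, mul_zero]

/-- `H¹(0,1)` as a normed space. -/
abbrev H1 : Type := H1Submodule

/-- The element of `L²(0,1)` underlying an element of `H¹(0,1)`. -/
def H1.fn (u : H1) : L2 := u.1.fst

/-- The weak derivative of an element of `H¹(0,1)`. -/
def H1.deriv (u : H1) : L2 := u.1.snd

theorem H1.norm_sq (u : H1) : ‖u‖ ^ 2 = ‖u.fn‖ ^ 2 + ‖u.deriv‖ ^ 2 := by
  exact WithLp.prod_norm_sq_eq_of_L2 u.1

theorem isClosed_H1 : IsClosed (H1Submodule : Set (WithLp 2 (L2 × L2))) := by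
  have : (H1Submodule : Set (WithLp 2 (L2 × L2))) = ⋂ (φ : ℝ → ℝ) (h : IsTest φ),
      {w | inner ℝ ((memLp_of_continuous h.continuous_deriv).toLp (_root_.deriv φ)) w.fst
        + inner ℝ ((memLp_of_continuous h.continuous).toLp φ) w.snd = 0} := by
    ext w
    simp only [mem_iInter, mem_ofPred_eq]
    exact hasWeakDeriv_iff _ _
  rw [this]
  refine isClosed_iInter fun φ => isClosed_iInter fun h => isClosed_eq ?_ continuous_const
  exact ((continuous_const.inner (WithLp.continuous_fst 2 L2 L2)).add
    (continuous_const.inner (WithLp.continuous_snd 2 L2 L2)))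

instance : CompleteSpace H1 := isClosed_H1.completeSpace_coe

theorem intervalIntegrable_L2 (g : L2) : IntervalIntegrable g volume 0 1 := by
  rw [intervalIntegrable_iff_integrableOn_Ioo_of_le zero_le_one]
  exact (Lp.memLp g).integrable (by norm_num)

/-- Integration by parts of a primitive of an `L²` function against a test function. -/
theorem integral_primitive_mul_deriv (g : L2) {φ : ℝ → ℝ} (h : IsTest φ) :
    ∫ x in Ioo (0 : ℝ) 1, (∫ y in (0 : ℝ)..x, g y) * deriv φ x
      = -∫ x in Ioo (0 : ℝ) 1, g x * φ x := by
  have hg := intervalIntegrable_L2 g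
  have hG := hg.absolutelyContinuousOnInterval_intervalIntegral (c := 0) (by simp)
  have hφ : AbsolutelyContinuousOnInterval φ 0 1 :=
    ((h.1.of_le (by simp)).contDiffOn (n := 1)).absolutelyContinuousOnInterval
  have h0 : φ 0 = 0 := image_eq_zero_of_notMem_tsupport fun hx => by simpa using h.2.2 hx
  have h1 : φ 1 = 0 := image_eq_zero_of_notMem_tsupport fun hx => by simpa using h.2.2 hx
  have key := hG.integral_mul_deriv_eq_deriv_mul hφ
  have e : ∫ x in (0 : ℝ)..1, deriv (fun x => ∫ y in (0 : ℝ)..x, g y) x * φ x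
      = ∫ x in (0 : ℝ)..1, g x * φ x := by
    refine intervalIntegral.integral_congr_ae ?_
    filter_upwards [hg.ae_hasDerivAt_integral] with x hx hx'
    rw [(hx (uIoc_subset_uIcc hx') 0 (by simp)).deriv]
  rw [e, h0, h1] at key
  simp only [intervalIntegral.integral_of_le zero_le_one, integral_Ioc_eq_integral_Ioo] at key
  simpa using key

/-- A fixed test function of integral one. -/
theorem exists_test_integral_one : ∃ ψ : ℝ → ℝ, IsTest ψ ∧ ∫ x, ψ x = 1 := by
  let B : ContDiffBump (1 / 2 : ℝ) := ⟨1 / 8, 1 / 4, by norm_num, by norm_num⟩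
  refine ⟨B.normed volume, ⟨B.contDiff_normed, B.hasCompactSupport_normed, ?_⟩,
    B.integral_normed⟩
  rw [B.tsupport_normed_eq, Real.closedBall_eq_Icc]
  intro x hx
  have h1 := hx.1
  have h2 := hx.2
  simp only [B] at h1 h2
  constructor <;> linarith

/-- A test function of integral zero is the derivative of a test function. -/
theorem exists_test_primitive {η : ℝ → ℝ} (h : IsTest η) (hi : ∫ x, η x = 0) :
    ∃ φ : ℝ → ℝ, IsTest φ ∧ deriv φ = η := by
  have hc := h.continuous
  have hd : ∀ x, HasDerivAt (fun x => ∫ y in (0 : ℝ)..x, η y) (η x) x := fun x =>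
    intervalIntegral.integral_hasDerivAt_right (hc.intervalIntegrable _ _)
      (hc.stronglyMeasurableAtFilter _ _) hc.continuousAt
  have hderiv : deriv (fun x => ∫ y in (0 : ℝ)..x, η y) = η := funext fun x => (hd x).deriv
  obtain ⟨α, β, hα, hβ, hsub⟩ : ∃ α β : ℝ, 0 < α ∧ β < 1 ∧ tsupport η ⊆ Icc α β := by
    rcases (tsupport η).eq_empty_or_nonempty with he | hne
    · exact ⟨1 / 2, 1 / 2, by norm_num, by norm_num, by simp [he]⟩
    · have hK : IsCompact (tsupport η) := h.2.1
      exact ⟨sInf (tsupport η), sSup (tsupport η), (h.2.2 (hK.sInf_mem hne)).1,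
        (h.2.2 (hK.sSup_mem hne)).2, fun x hx =>
        ⟨csInf_le hK.bddBelow hx, le_csSup hK.bddAbove hx⟩⟩
  have hz : ∀ y, y ∉ Icc α β → η y = 0 := fun y hy =>
    image_eq_zero_of_notMem_tsupport fun hy' => hy (hsub hy')
  have hint : Integrable η := hc.integrable_of_hasCompactSupport h.2.1
  have hsupp : Function.support (fun x => ∫ y in (0 : ℝ)..x, η y) ⊆ Icc α β := by
    intro x hx
    by_contra hx'
    apply hx
    rw [mem_Icc, not_and_or, not_le, not_le] at hx'
    have e1 : ∫ y in Iic (0 : ℝ), η y = 0 := setIntegral_eq_zero_of_forall_eq_zero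
      fun y hy => hz y fun hy' => by
        have := hy'.1
        have : y ≤ 0 := hy
        linarith
    have e2 : (∫ y in (0 : ℝ)..x, η y) = ∫ y in Iic x, η y := by
      rw [← intervalIntegral.integral_Iic_sub_Iic hint.integrableOn hint.integrableOn, e1,
        sub_zero]
    show (∫ y in (0 : ℝ)..x, η y) = 0
    rw [e2]
    rcases hx' with hx' | hx'
    · refine setIntegral_eq_zero_of_forall_eq_zero fun y hy => hz y fun hy' => ?_
      have := hy'.1
      have : y ≤ x := hy
      linarith
    · rw [← hi]
      refine setIntegral_eq_integral_of_forall_compl_eq_zero fun y hy => hz y fun hy' => hy ?_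
      exact hy'.2.trans hx'.le
  have htsupp : tsupport (fun x => ∫ y in (0 : ℝ)..x, η y) ⊆ Icc α β :=
    closure_minimal hsupp isClosed_Icc
  refine ⟨fun x => ∫ y in (0 : ℝ)..x, η y, ⟨?_, ?_, ?_⟩, hderiv⟩
  · rw [contDiff_infty_iff_deriv]
    exact ⟨fun x => (hd x).differentiableAt, by rw [hderiv]; exact h.1⟩
  · exact isCompact_Icc.of_isClosed_subset (isClosed_tsupport _) htsupp
  · intro x hx
    have := htsupp hx
    exact ⟨hα.trans_le this.1, this.2.trans_lt hβ⟩

/-- Every element of `H¹(0,1)` has a representative that is continuous on `[0,1]`; it is the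
primitive of the weak derivative. -/
theorem H1.exists_rep (u : H1) : ∃ F : ℝ → ℝ, ContinuousOn F (Icc (0 : ℝ) 1) ∧
    u.fn =ᵐ[vol01] F ∧
    ∀ x ∈ Icc (0 : ℝ) 1, F x = F 0 + ∫ y in (0 : ℝ)..x, u.deriv y := by
  set G : ℝ → ℝ := fun x => ∫ y in (0 : ℝ)..x, u.deriv y with hG
  have hGc : ContinuousOn G (Icc (0 : ℝ) 1) := by
    have := ((intervalIntegrable_L2 u.deriv).absolutelyContinuousOnInterval_intervalIntegral
      (c := 0) (by simp)).continuousOn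
    rwa [uIcc_of_le zero_le_one] at this
  have hfi : IntegrableOn u.fn (Ioo (0 : ℝ) 1) := (Lp.memLp u.fn).integrable (by norm_num)
  have hGi : IntegrableOn G (Ioo (0 : ℝ) 1) :=
    (hGc.integrableOn_compact isCompact_Icc).mono_set Ioo_subset_Icc_self
  have hmul : ∀ {w φ : ℝ → ℝ}, IntegrableOn w (Ioo (0 : ℝ) 1) → IsTest φ →
      IntegrableOn (fun x => w x * φ x) (Ioo (0 : ℝ) 1) := by
    intro w φ hw hφ
    obtain ⟨C, hC⟩ := hφ.continuous.bounded_above_of_compact_support hφ.2.1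
    exact hw.mul_bdd (c := C) hφ.continuous.aestronglyMeasurable (Filter.Eventually.of_forall hC)
  obtain ⟨ψ, hψ, hψ1⟩ := exists_test_integral_one
  set k : ℝ := ∫ x in Ioo (0 : ℝ) 1, (u.fn x - G x) * ψ x with hk
  have hdi : IntegrableOn (fun x => u.fn x - G x) (Ioo (0 : ℝ) 1) := hfi.sub hGi
  have hall : ∀ {φ : ℝ → ℝ}, IsTest φ → ∫ x in Ioo (0 : ℝ) 1, φ x = ∫ x, φ x := by
    intro φ hφ
    exact setIntegral_eq_integral_of_forall_compl_eq_zero fun y hy =>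
      image_eq_zero_of_notMem_tsupport fun hy' => hy (hφ.2.2 hy')
  have main : ∀ {φ : ℝ → ℝ}, IsTest φ →
      ∫ x in Ioo (0 : ℝ) 1, (u.fn x - G x) * φ x = k * ∫ x, φ x := by
    intro φ hφ
    set m : ℝ := ∫ x, φ x with hm
    have hη : IsTest (fun x => φ x - m * ψ x) := by
      refine ⟨hφ.1.sub (contDiff_const.mul hψ.1), hφ.2.1.sub hψ.2.1.mul_left, ?_⟩
      refine (closure_minimal (fun x hx => ?_)
        ((isClosed_tsupport φ).union (isClosed_tsupport ψ))).trans (union_subset hφ.2.2 hψ.2.2)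
      by_contra hcon
      rw [mem_union, not_or] at hcon
      exact hx (by simp [image_eq_zero_of_notMem_tsupport hcon.1,
        image_eq_zero_of_notMem_tsupport hcon.2])
    have hη0 : ∫ x, (φ x - m * ψ x) = 0 := by
      rw [integral_sub (hφ.continuous.integrable_of_hasCompactSupport hφ.2.1)
        ((hψ.continuous.integrable_of_hasCompactSupport hψ.2.1).const_mul m),
        integral_const_mul, hψ1, mul_one, sub_self]
    obtain ⟨θ, hθ, hθd⟩ := exists_test_primitive hη hη0
    have e1 := u.2 θ hθ
    have e2 := integral_primitive_mul_deriv u.deriv hθ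
    rw [hθd] at e1 e2
    have e3 : ∫ x in Ioo (0 : ℝ) 1, (u.fn x - G x) * (φ x - m * ψ x) = 0 := by
      simp only [sub_mul (u.fn _)]
      rw [integral_sub (hmul hfi hη) (hmul hGi hη), sub_eq_zero]
      exact e1.trans e2.symm
    have e4 : ∫ x in Ioo (0 : ℝ) 1, (u.fn x - G x) * (φ x - m * ψ x)
        = (∫ x in Ioo (0 : ℝ) 1, (u.fn x - G x) * φ x) - m * k := by
      rw [hk, ← integral_const_mul, ← integral_sub (hmul hdi hφ) ((hmul hdi hψ).const_mul m)]
      refine integral_congr_ae (Filter.Eventually.of_forall fun x => ?_)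
      ring
    linarith
  have hae : ∀ᵐ x ∂volume, x ∈ Ioo (0 : ℝ) 1 → u.fn x - G x - k = 0 := by
    have hki : IntegrableOn (fun _ : ℝ => k) (Ioo (0 : ℝ) 1) :=
      integrableOn_const (by simp)
    refine isOpen_Ioo.ae_eq_zero_of_integral_contDiff_smul_eq_zero
      (hdi.sub hki).locallyIntegrableOn fun φ h1 h2 h3 => ?_
    have hφ : IsTest φ := ⟨h1, h2, h3⟩
    rw [← setIntegral_eq_integral_of_forall_compl_eq_zero (s := Ioo (0 : ℝ) 1)
      fun y hy => by
        rw [image_eq_zero_of_notMem_tsupport fun hy' => hy (h3 hy'), zero_smul]]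
    have : ∫ x in Ioo (0 : ℝ) 1, φ x • (u.fn x - G x - k)
        = (∫ x in Ioo (0 : ℝ) 1, (u.fn x - G x) * φ x) - ∫ x in Ioo (0 : ℝ) 1, k * φ x := by
      rw [← integral_sub (hmul hdi hφ) (hmul hki hφ)]
      refine integral_congr_ae (Filter.Eventually.of_forall fun x => ?_)
      simp only [smul_eq_mul]
      ring
    refine this.trans ?_
    rw [main hφ, integral_const_mul, hall hφ, sub_self]
  refine ⟨fun x => k + G x, continuousOn_const.add hGc, ?_, fun x _ => by simp [hG]⟩
  refine (ae_restrict_iff' measurableSet_Ioo).2 ?_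
  filter_upwards [hae] with x hx hx'
  have := hx hx'
  linarith

/-- The continuous representative on `[0,1]` of an element of `H¹(0,1)`; its values at `0` and
`1` are the boundary traces. -/
def H1.rep (u : H1) : ℝ → ℝ := Classical.choose u.exists_rep

theorem H1.rep_continuousOn (u : H1) : ContinuousOn u.rep (Icc (0 : ℝ) 1) :=
  (Classical.choose_spec u.exists_rep).1

theorem H1.fn_ae_eq_rep (u : H1) : u.fn =ᵐ[vol01] u.rep :=
  (Classical.choose_spec u.exists_rep).2.1

theorem H1.rep_eq (u : H1) {x : ℝ} (hx : x ∈ Icc (0 : ℝ) 1) :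
    u.rep x = u.rep 0 + ∫ y in (0 : ℝ)..x, u.deriv y :=
  (Classical.choose_spec u.exists_rep).2.2 x hx

/-! ### Mild solutions of `Y' = A Y` -/

/-- `Y` is a mild solution on `[0,∞)` of `Y' = A Y`, `Y(0) = Y₀`: it is continuous and, for every
`t ≥ 0`, `∫₀ᵗ Y` belongs to the domain of `A` and `Y(t) = Y₀ + A ∫₀ᵗ Y`. The operator `A` is given
by its graph: `A y z` means that `y` is in the domain and `z` is its image. -/
def IsMildSolution {X : Type*} [NormedAddCommGroup X] [NormedSpace ℝ X]
    (A : X → X → Prop) (Y₀ : X) (Y : ℝ → X) : Prop :=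
  ContinuousOn Y (Ici 0) ∧ ∀ t : ℝ, 0 ≤ t → A (∫ s in (0 : ℝ)..t, Y s) (Y t - Y₀)

/-- `Y` is the unique mild solution on `[0,∞)`. -/
def IsUniqueMildSolution {X : Type*} [NormedAddCommGroup X] [NormedSpace ℝ X]
    (A : X → X → Prop) (Y₀ : X) (Y : ℝ → X) : Prop :=
  IsMildSolution A Y₀ Y ∧ ∀ Z : ℝ → X, IsMildSolution A Y₀ Z → EqOn Z Y (Ici 0)

/-! ### The three systems -/

/-- Graph of the operator `(u, v, p) ↦ (v, u_xx, ε⁻¹ p_xx)` of the coupled system, with domain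
given by `u, p ∈ H²(0,1)`, `v ∈ H¹(0,1)`, `u(0) = v(0) = 0`, `u_x(1) = -a v(1) + b p(0)`,
`p_x(0) = c p(0)` and `p_x(1) = d u(1)`. Here `w`, `q`, `ux`, `px` are `v`, `p`, `u_x`, `p_x`
as elements of `H¹(0,1)`. -/
def fullOp (a b c d ε : ℝ) (Y Z : H1 × L2 × L2) : Prop :=
  ∃ w q ux px : H1,
    w.fn = Y.2.1 ∧ q.fn = Y.2.2 ∧ ux.fn = Y.1.deriv ∧ px.fn = q.deriv ∧
    Y.1.rep 0 = 0 ∧ w.rep 0 = 0 ∧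
    ux.rep 1 = -a * w.rep 1 + b * q.rep 0 ∧
    px.rep 0 = c * q.rep 0 ∧ px.rep 1 = d * Y.1.rep 1 ∧
    Z = (w, ux.deriv, ε⁻¹ • px.deriv)

/-- Graph of the operator `(u, v) ↦ (v, u_xx)` of the reduced wave equation, with domain given by
`u ∈ H²(0,1)`, `v ∈ H¹(0,1)`, `u(0) = v(0) = 0` and `u_x(1) = -a v(1) + (bd/c) u(1)`. -/
def reducedOp (a b c d : ℝ) (Y Z : H1 × L2) : Prop :=
  ∃ w ux : H1,
    w.fn = Y.2 ∧ ux.fn = Y.1.deriv ∧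
    Y.1.rep 0 = 0 ∧ w.rep 0 = 0 ∧
    ux.rep 1 = -a * w.rep 1 + b * d / c * Y.1.rep 1 ∧
    Z = (w, ux.deriv)

/-- Graph of the operator `p ↦ p_xx` of the boundary-layer heat equation, with domain given by
`p ∈ H²(0,1)`, `p_x(0) = c p(0)` and `p_x(1) = 0`. -/
def layerOp (c : ℝ) (P Z : L2) : Prop :=
  ∃ q px : H1,
    q.fn = P ∧ px.fn = q.deriv ∧ px.rep 0 = c * q.rep 0 ∧ px.rep 1 = 0 ∧ Z = px.deriv

/-- The function `x ↦ (1 + c x) / c` as an element of `L²(0,1)`. -/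
def profile (c : ℝ) : L2 :=
  (memLp_of_continuous (φ := fun x : ℝ => (1 + c * x) / c) (by fun_prop)).toLp _

/-! ### The parameters -/

/-- `η = (√3 + 1) / (√3 - 1)`. -/
def eta : ℝ := (√3 + 1) / (√3 - 1)

/-- `μ*(a) = log (|1 + a| / (√2 |1 - a|))`. -/
def muStar (a : ℝ) : ℝ := Real.log (|1 + a| / (√2 * |1 - a|))

/-- `F(μ) = 2 sinh μ + 10 cosh μ`. -/
def Fmu (μ : ℝ) : ℝ := 2 * Real.sinh μ + 10 * Real.cosh μ

end HeatWave

end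

open HeatWave

/-! All the data are small, so the three solutions need not be compared: each is small by itself.
With E = ε^(3/2), the bounds on the reduced data and on the differences give u₀ and u₁ of size E.
Hence d u₀(1) is O(E) and, as E ≤ ε, p₀ is O(ε). It therefore suffices that every system decays at
rate μ/8 with constants independent of ε; the triangle inequality does the rest.

For the waves, the Lyapunov form weights the Riemann invariants v ± u_x by e^{±μx}. Integration by
parts yields damping -μ/2 and a boundary term at x = 1, which the bound μ ≤ μ* reduces to 3 cosh μ
q², q being the boundary input (`waveForm_dissipation`). In the reduced system q = (bd/c) u(1) is
absorbed by the damping. In the coupled system q = b p(0), and ε‖p‖² is added to the form: a large c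
absorbs p(0)², a small d absorbs d u(1) (`fullOp_dissipation`). The initial value of this form is
O(ε³), which gives ε^(3/2) for the wave part and only ε for p, because of the weight ε. The boundary
layer decays in the H¹ energy ‖p_x‖² + c p(0)².

Well-posedness is a Hille–Yosida argument phrased with the bounded inverse R of the generator, which
is explicit in each system. Dissipativity reads B(Rz, z) ≤ -ρ B(Rz, Rz), the mild equation reads
R(Y(t) - Y₀) = ∫Y, and the Yosida approximations are the inverses of R - δ (`exists_solution`).
Uniqueness is the energy estimate for the time integral of a difference (`IsMildSolution.unique`).
-/

open HeatWave

namespace HeatWave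

open Filter Topology

/-! ### Coercive forms: solvability, dense range, energy derivatives -/

section Semigroup

variable {X H : Type*} [NormedAddCommGroup X] [NormedSpace ℝ X]
  [NormedAddCommGroup H] [InnerProductSpace ℝ H] [CompleteSpace H]

/-- Lax–Milgram for operators on a space isomorphic to a Hilbert space: if `B` is a coercive form
and `-B (T z) z ≥ δ B z z`, then every functional is of the form `B (T v)`. -/
theorem exists_form_eq (e : X ≃L[ℝ] H) (B : X →L[ℝ] X →L[ℝ] ℝ) {k : ℝ} (hk : 0 < k)
    (hB : ∀ x, k * ‖x‖ ^ 2 ≤ B x x) (T : X →L[ℝ] X) {δ : ℝ} (hδ : 0 < δ)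
    (hT : ∀ z, δ * B z z ≤ -B (T z) z) (f : X →L[ℝ] ℝ) : ∃ v, ∀ w, B (T v) w = f w := by
  -- The summand 1 keeps m positive even on the trivial space.
  set m : ℝ := ‖(e : X →L[ℝ] H)‖ + 1 with hm
  have hm0 : 0 < m := by positivity
  have hsq : ∀ v : H, k / m ^ 2 * (‖v‖ * ‖v‖) ≤ k * ‖e.symm v‖ ^ 2 := by
    intro v
    have h1 : ‖(e : X →L[ℝ] H) (e.symm v)‖ ≤ _ := (e : X →L[ℝ] H).le_opNorm (e.symm v)
    simp only [ContinuousLinearEquiv.coe_coe, ContinuousLinearEquiv.apply_symm_apply] at h1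
    have h1' : ‖v‖ ≤ m * ‖e.symm v‖ := by nlinarith [norm_nonneg (e.symm v)]
    have h2 : ‖v‖ * ‖v‖ ≤ m ^ 2 * ‖e.symm v‖ ^ 2 := by
      nlinarith [norm_nonneg v, norm_nonneg (e.symm v), mul_nonneg hm0.le (norm_nonneg (e.symm v))]
    rw [div_mul_eq_mul_div, div_le_iff₀ (by positivity)]
    nlinarith
  let B₂ : H →L[ℝ] H →L[ℝ] ℝ :=
    (-B).bilinearComp (T ∘L (e.symm : H →L[ℝ] X)) (e.symm : H →L[ℝ] X)
  have hB₂ : IsCoercive B₂ := by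
    refine ⟨δ * (k / m ^ 2), by positivity, fun v => ?_⟩
    have h1 := hT (e.symm v)
    have h2 := hB (e.symm v)
    have h3 := hsq v
    change _ ≤ -B (T (e.symm v)) (e.symm v)
    calc δ * (k / m ^ 2) * ‖v‖ * ‖v‖ = δ * (k / m ^ 2 * (‖v‖ * ‖v‖)) := by ring
      _ ≤ δ * B (e.symm v) (e.symm v) := by gcongr; linarith
      _ ≤ _ := h1
  set r := (InnerProductSpace.toDual ℝ H).symm (f ∘L (e.symm : H →L[ℝ] X)) with hr
  obtain ⟨v, hv⟩ := (hB₂.continuousLinearEquivOfBilin).surjective r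
  refine ⟨-e.symm v, fun w => ?_⟩
  have h1 := hB₂.continuousLinearEquivOfBilin_apply v (e w)
  have h3 : B₂ v (e w) = -B (T (e.symm v)) w := by simp [B₂]
  rw [hv, hr, InnerProductSpace.toDual_symm_apply, h3] at h1
  simp only [ContinuousLinearMap.comp_apply, ContinuousLinearEquiv.coe_coe,
    ContinuousLinearEquiv.symm_apply_apply] at h1
  simp [h1]

theorem eq_zero_of_form_nonpos {B : X →L[ℝ] X →L[ℝ] ℝ} {k : ℝ} (hk : 0 < k)
    (hB : ∀ x, k * ‖x‖ ^ 2 ≤ B x x) {x : X} (hx : B x x ≤ 0) : x = 0 := by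
  have h1 := hB x
  have : ‖x‖ ^ 2 ≤ 0 := by
    by_contra hc
    push Not at hc
    nlinarith
  exact norm_eq_zero.1 (pow_eq_zero_iff (two_ne_zero) |>.1 (le_antisymm this (sq_nonneg _)))

/-- If B (T v) represents the functional B h, the form vanishes on T v - h, and coercivity
concludes. -/
theorem surjective_of_form (e : X ≃L[ℝ] H) (B : X →L[ℝ] X →L[ℝ] ℝ) {k : ℝ} (hk : 0 < k)
    (hB : ∀ x, k * ‖x‖ ^ 2 ≤ B x x) (T : X →L[ℝ] X) {δ : ℝ} (hδ : 0 < δ)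
    (hT : ∀ z, δ * B z z ≤ -B (T z) z) : Function.Surjective T := by
  intro h
  obtain ⟨v, hv⟩ := exists_form_eq e B hk hB T hδ hT (B h)
  refine ⟨v, sub_eq_zero.1 (eq_zero_of_form_nonpos hk hB ?_)⟩
  simp [hv (T v - h), sub_apply]

/-- The range of a dissipative injective operator is dense. -/
theorem denseRange_of_form (e : X ≃L[ℝ] H) (B : X →L[ℝ] X →L[ℝ] ℝ) {k : ℝ} (hk : 0 < k)
    (hB : ∀ x, k * ‖x‖ ^ 2 ≤ B x x) (hsymm : ∀ x y, B x y = B y x)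
    (R : X →L[ℝ] X) (hinj : ∀ z, R z = 0 → z = 0) {ρ : ℝ} (hρ : 0 < ρ)
    (hR : ∀ z, B (R z) z ≤ -(ρ * B (R z) (R z))) : DenseRange R := by
  have hd : DenseRange (e ∘ R) := by
    let S : Submodule ℝ H := ((e : X →L[ℝ] H) ∘L R).range
    have hS : Sᗮ = ⊥ := by
      rw [eq_bot_iff]
      intro h hh
      rw [Submodule.mem_orthogonal'] at hh
      -- Riesz representation for B, from T = -id and δ = 1: the functional ⟨h, e ·⟩ becomes B g. If
      -- h is orthogonal to the range, then B(g, R g) = 0, and dissipativity at g forces R g = 0.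
      obtain ⟨v, hv⟩ := exists_form_eq e B hk hB (-ContinuousLinearMap.id ℝ X) one_pos
        (fun z => by simp) ((innerSL ℝ h) ∘L (e : X →L[ℝ] H))
      set g := (-ContinuousLinearMap.id ℝ X) v
      have h1 : B g (R g) = 0 := by
        rw [hv]
        exact hh _ ⟨g, rfl⟩
      have h2 := hR g
      rw [hsymm, h1] at h2
      have h3 : R g = 0 := eq_zero_of_form_nonpos hk hB (by nlinarith)
      have h5 := hv (e.symm h)
      rw [hinj _ h3] at h5
      simpa using h5.symm
    exact Submodule.dense_iff_topologicalClosure_eq_top.2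
      ((Submodule.topologicalClosure_eq_top_iff (K := S)).2 hS)
  have h3 := e.symm.surjective.denseRange.comp hd e.symm.continuous
  have h4 : (e.symm ∘ (e ∘ R)) = R := by
    funext x; simp
  rwa [h4] at h3

/-- Exponential decay from a differential inequality. -/
theorem le_exp_of_deriv_le {f f' : ℝ → ℝ} {ρ : ℝ} (hf : ∀ t, HasDerivAt f (f' t) t)
    (h : ∀ t, f' t ≤ -(2 * ρ * f t)) {t : ℝ} (ht : 0 ≤ t) :
    f t ≤ Real.exp (-(2 * ρ * t)) * f 0 := by
  have hd : ∀ t, HasDerivAt (fun t => Real.exp (2 * ρ * t) * f t)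
      (Real.exp (2 * ρ * t) * (2 * ρ) * f t + Real.exp (2 * ρ * t) * f' t) t := by
    intro t
    have h1 : HasDerivAt (fun t => 2 * ρ * t) (2 * ρ) t := by
      simpa using (hasDerivAt_id t).const_mul (2 * ρ)
    exact h1.exp.mul (hf t)
  have hanti : Antitone (fun t => Real.exp (2 * ρ * t) * f t) := by
    refine antitone_of_deriv_nonpos (fun t => (hd t).differentiableAt) fun t => ?_
    rw [(hd t).deriv]
    have := h t
    have h2 := Real.exp_pos (2 * ρ * t)
    nlinarith
  have h1 := hanti ht
  simp only [mul_zero, Real.exp_zero, one_mul] at h1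
  rw [Real.exp_neg, inv_mul_eq_div, le_div_iff₀ (Real.exp_pos _)]
  linarith

theorem hasDerivAt_form (B : X →L[ℝ] X →L[ℝ] ℝ) (hsymm : ∀ x y, B x y = B y x)
    {y : ℝ → X} {y' : X} {t : ℝ} (hy : HasDerivAt y y' t) :
    HasDerivAt (fun t => B (y t) (y t)) (2 * B (y t) y') t := by
  have h1 : HasDerivAt (fun t => B (y t)) (B y') t := B.hasFDerivAt.comp_hasDerivAt t hy
  have h2 := h1.clm_apply hy
  refine h2.congr_deriv ?_
  rw [hsymm y' (y t)]
  ring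

end Semigroup

/-! ### Yosida approximation through the bounded inverse -/

section Yosida

variable {X : Type*} [NormedAddCommGroup X] [NormedSpace ℝ X] {B : X →L[ℝ] X →L[ℝ] ℝ}
  {R : X →L[ℝ] X} {k ρ : ℝ}

theorem form_nonneg (hk : 0 < k) (hB : ∀ x, k * ‖x‖ ^ 2 ≤ B x x) (x : X) : 0 ≤ B x x :=
  le_trans (by positivity) (hB x)

/-- Approximating costs a little of the decay rate. After clearing the denominator the claim is
B(Rz, z) + ρ B(Rz, Rz) ≤ δ (B(z, z) + ρ B(Rz, z)). The left side is nonpositive by dissipativity;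
the right side is nonnegative by positivity of B at ρ R z + z. -/
theorem form_yosida_le (hk : 0 < k) (hB : ∀ x, k * ‖x‖ ^ 2 ≤ B x x)
    (hsymm : ∀ x y, B x y = B y x) (hρ : 0 < ρ)
    (hR : ∀ z, B (R z) z ≤ -(ρ * B (R z) (R z))) {δ : ℝ} (hδ : 0 < δ) (z : X) :
    B (R z - δ • z) z ≤ -(ρ / (1 + ρ * δ) * B (R z - δ • z) (R z - δ • z)) := by
  have h0 := form_nonneg hk hB (ρ • R z + z)
  have h1 := hR z
  have h2 := hsymm z (R z)
  simp only [map_add, map_sub, map_smul, add_apply, sub_apply, smul_apply, smul_eq_mul] at h0 ⊢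
  rw [h2] at *
  have h3 := form_nonneg hk hB (R z)
  have h4 : ρ * -(B (R z) z) ≤ B z z := by nlinarith
  rw [div_mul_eq_mul_div, ← sub_nonneg, neg_sub_left, neg_add_rev, neg_sub, add_comm,
    ← sub_eq_add_neg, sub_nonneg, div_le_iff₀ (by positivity)]
  nlinarith [mul_pos hρ hδ, mul_le_mul_of_nonneg_left h4 hδ.le,
    mul_le_mul_of_nonneg_left h1 hδ.le]

/-- The cross term -2δ B(Rz, z) is nonnegative. This makes R - δ injective and bounds its inverse by
1/δ in the form norm. -/
theorem form_yosida_sq_le (hk : 0 < k) (hB : ∀ x, k * ‖x‖ ^ 2 ≤ B x x)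
    (hsymm : ∀ x y, B x y = B y x) (hρ : 0 < ρ)
    (hR : ∀ z, B (R z) z ≤ -(ρ * B (R z) (R z))) {δ : ℝ} (hδ : 0 < δ) (z : X) :
    δ ^ 2 * B z z ≤ B (R z - δ • z) (R z - δ • z) := by
  have h1 := hR z
  have h2 := hsymm z (R z)
  have h3 := form_nonneg hk hB (R z)
  simp only [map_sub, map_smul, sub_apply, smul_apply, smul_eq_mul]
  rw [h2]
  nlinarith [mul_nonneg hρ.le h3]

theorem form_add_le (hk : 0 < k) (hB : ∀ x, k * ‖x‖ ^ 2 ≤ B x x)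
    (hsymm : ∀ x y, B x y = B y x) (x y : X) :
    B (x + y) (x + y) ≤ 2 * B x x + 2 * B y y := by
  have h0 := form_nonneg hk hB (x - y)
  have h2 := hsymm y x
  simp only [map_add, map_sub, add_apply, sub_apply] at h0 ⊢
  linarith

theorem two_mul_form_le (hk : 0 < k) (hB : ∀ x, k * ‖x‖ ^ 2 ≤ B x x)
    (hsymm : ∀ x y, B x y = B y x) (x y : X) :
    2 * B x y ≤ B x x + B y y := by
  have h0 := form_nonneg hk hB (x - y)
  have h2 := hsymm y x
  simp only [map_sub, sub_apply] at h0
  linarith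

variable [CompleteSpace X]

/-- Injectivity comes from `form_yosida_sq_le`; the open mapping theorem then makes the inverse
bounded. -/
theorem exists_yosida (hk : 0 < k) (hB : ∀ x, k * ‖x‖ ^ 2 ≤ B x x)
    (hsymm : ∀ x y, B x y = B y x) (hρ : 0 < ρ)
    (hR : ∀ z, B (R z) z ≤ -(ρ * B (R z) (R z))) {δ : ℝ} (hδ : 0 < δ)
    (hsurj : Function.Surjective (R - δ • ContinuousLinearMap.id ℝ X)) :
    ∃ A : X →L[ℝ] X, (∀ x, R (A x) - δ • A x = x) ∧ ∀ x, A (R x - δ • x) = x := by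
  have hker : (R - δ • ContinuousLinearMap.id ℝ X).ker = ⊥ := by
    rw [LinearMap.ker_eq_bot']
    intro z hz
    have hz' : R z - δ • z = 0 := hz
    have h1 := form_yosida_sq_le hk hB hsymm hρ hR hδ z
    rw [hz'] at h1
    simp only [map_zero] at h1
    exact eq_zero_of_form_nonpos hk hB (by
      by_contra hc
      push Not at hc
      have : 0 < δ ^ 2 * B z z := by positivity
      linarith)
  let T := ContinuousLinearEquiv.ofBijective _ hker (LinearMap.range_eq_top.2 hsurj)
  refine ⟨T.symm, fun x => ?_, fun x => ?_⟩
  · exact T.apply_symm_apply x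
  · exact T.symm_apply_apply x

theorem exists_flow (A : X →L[ℝ] X) : ∃ E : ℝ → X →L[ℝ] X, (∀ x, E 0 x = x) ∧
    (∀ x t, HasDerivAt (fun t => E t x) (A (E t x)) t) ∧ ∀ x t, A (E t x) = E t (A x) := by
  refine ⟨fun t => NormedSpace.exp (t • A), fun x => by simp, fun x t => ?_, fun x t => ?_⟩
  · have h := (hasDerivAt_exp_smul_const' (𝕂 := ℝ) A t).clm_apply (hasDerivAt_const t x)
    simpa using h
  · have h : Commute A (NormedSpace.exp (t • A)) :=
      ((Commute.refl A).smul_right t).exp_right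
    exact DFunLike.congr_fun h.eq x

/-- The Yosida approximation: solutions of `(R - δ) y' = y`. -/
theorem exists_yosida_flow (hk : 0 < k) (hB : ∀ x, k * ‖x‖ ^ 2 ≤ B x x)
    (hsymm : ∀ x y, B x y = B y x) (hρ : 0 < ρ)
    (hR : ∀ z, B (R z) z ≤ -(ρ * B (R z) (R z))) {δ : ℝ} (hδ : 0 < δ)
    (hsurj : Function.Surjective (R - δ • ContinuousLinearMap.id ℝ X)) :
    ∃ (E : ℝ → X →L[ℝ] X) (E' : ℝ → X → X), (∀ x, E 0 x = x) ∧
      (∀ x t, HasDerivAt (fun t => E t x) (E' t x) t) ∧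
      (∀ x t, R (E' t x) - δ • E' t x = E t x) ∧
      (∀ x t, 0 ≤ t → B (E t x) (E t x) ≤ Real.exp (-(2 * (ρ / (1 + ρ * δ)) * t)) * B x x) ∧
      (∀ w t, 0 ≤ t → B (E' t (R w)) (E' t (R w)) ≤ 4 * B w w) := by
  obtain ⟨A, hA1, hA2⟩ := exists_yosida hk hB hsymm hρ hR hδ hsurj
  obtain ⟨E, hE0, hE1, hE2⟩ := exists_flow A
  have hdecay : ∀ x t, 0 ≤ t →
      B (E t x) (E t x) ≤ Real.exp (-(2 * (ρ / (1 + ρ * δ)) * t)) * B x x := by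
    intro x t ht
    have h1 := le_exp_of_deriv_le (fun t => hasDerivAt_form B hsymm (hE1 x t))
      (ρ := ρ / (1 + ρ * δ)) (fun t => ?_) ht
    · simpa [hE0] using h1
    · have h2 := form_yosida_le hk hB hsymm hρ hR hδ (A (E t x))
      rw [hA1] at h2
      linarith
  refine ⟨E, fun t x => A (E t x), hE0, hE1, fun x t => hA1 _, hdecay, fun w t ht => ?_⟩
  have h1 := hdecay (A (R w)) t ht
  have h2 : Real.exp (-(2 * (ρ / (1 + ρ * δ)) * t)) ≤ 1 := by
    rw [Real.exp_le_one_iff, neg_nonpos]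
    positivity
  -- For initial values in the range of R the time derivative stays bounded as δ → 0: it is the flow
  -- applied to A (R w), and δ A w is no larger than w in the form, whence 4 = 2 + 2.
  have h3 : A (R w) = w + δ • A w := by
    have := hA2 w
    rw [map_sub, map_smul] at this
    exact sub_eq_iff_eq_add.1 this
  have h4 := form_yosida_sq_le hk hB hsymm hρ hR hδ (A w)
  rw [hA1] at h4
  have h5 := form_add_le hk hB hsymm w (δ • A w)
  rw [← h3] at h5
  have h6 : B (δ • A w) (δ • A w) = δ ^ 2 * B (A w) (A w) := by
    simp only [map_smul, smul_apply, smul_eq_mul]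
    ring
  have h7 := form_nonneg hk hB (A (R w))
  dsimp only
  rw [hE2]
  nlinarith

end Yosida

/-! ### Generation theorem: the limit δ → 0 -/

section Generation

variable {X : Type*} [NormedAddCommGroup X] [NormedSpace ℝ X] {B : X →L[ℝ] X →L[ℝ] ℝ}
  {R : X →L[ℝ] X} {k ρ : ℝ}

/-- Here z and y are the time derivatives of two approximate flows, and R z - δ z, R y - γ y are the
flows themselves. The left side is thus half the derivative of their squared distance in the form,
and the bound makes the approximations Cauchy. -/
theorem form_yosida_diff_le (hk : 0 < k) (hB : ∀ x, k * ‖x‖ ^ 2 ≤ B x x)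
    (hsymm : ∀ x y, B x y = B y x) (hρ : 0 < ρ)
    (hR : ∀ z, B (R z) z ≤ -(ρ * B (R z) (R z))) {δ γ K : ℝ} (hδ : 0 < δ) (hγ : 0 < γ)
    {z y : X} (hz : B z z ≤ K) (hy : B y y ≤ K) :
    B ((R z - δ • z) - (R y - γ • y)) (z - y) ≤ (δ + γ) * K := by
  have h1 := hR (z - y)
  have h2 := form_nonneg hk hB (R (z - y))
  have h3 := two_mul_form_le hk hB hsymm z y
  have h4 := form_nonneg hk hB z
  have h5 := form_nonneg hk hB y
  have h6 : B (R (z - y)) (z - y) ≤ 0 := by nlinarith [mul_nonneg hρ.le h2]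
  have e : B ((R z - δ • z) - (R y - γ • y)) (z - y)
      = B (R (z - y)) (z - y) - δ * B z z - γ * B y y + (δ + γ) * B z y := by
    have h7 := hsymm y z
    simp only [map_sub, map_smul, sub_apply, smul_apply, smul_eq_mul]
    rw [h7]
    ring
  rw [e]
  nlinarith [mul_nonneg hδ.le h4, mul_nonneg hγ.le h5]

theorem le_mul_of_deriv_le {f f' : ℝ → ℝ} {K : ℝ} (hf : ∀ t, HasDerivAt f (f' t) t)
    (h : ∀ t, 0 ≤ t → f' t ≤ K) {t : ℝ} (ht : 0 ≤ t) : f t ≤ f 0 + K * t := by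
  have hd : ∀ t, HasDerivAt (fun t => f t - K * t) (f' t - K) t := fun t =>
    ((hf t).sub ((hasDerivAt_id t).const_mul K)).congr_deriv (by simp)
  have hanti : AntitoneOn (fun t => f t - K * t) (Ici 0) := by
    refine antitoneOn_of_deriv_nonpos (convex_Ici 0)
      (fun t _ => (hd t).continuousAt.continuousWithinAt)
      (fun t _ => (hd t).differentiableAt.differentiableWithinAt) fun t ht' => ?_
    rw [interior_Ici] at ht'
    rw [(hd t).deriv]
    linarith [h t (le_of_lt ht')]
  have := hanti (mem_Ici.2 le_rfl) (mem_Ici.2 ht) ht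
  simp only [mul_zero, sub_zero] at this
  linarith

variable [CompleteSpace X]

/-- **Generation theorem.** If `R` is a bounded operator which is dissipative for a coercive form
`B`, such that `R - δ` is onto for `δ > 0` and `R` has dense range, then the equation
`(R Y)' = Y` has a continuous solution for every initial value, and it decays exponentially. -/
theorem exists_solution (hk : 0 < k) (hB : ∀ x, k * ‖x‖ ^ 2 ≤ B x x)
    (hsymm : ∀ x y, B x y = B y x) (hρ : 0 < ρ)
    (hR : ∀ z, B (R z) z ≤ -(ρ * B (R z) (R z)))
    (hsurj : ∀ δ : ℝ, 0 < δ → Function.Surjective (R - δ • ContinuousLinearMap.id ℝ X))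
    (hdense : DenseRange R) (x₀ : X) :
    ∃ Y : ℝ → X, Continuous Y ∧
      (∀ t, 0 ≤ t → R (Y t - x₀) = ∫ s in (0 : ℝ)..t, Y s) ∧
      ∀ t, 0 ≤ t → B (Y t) (Y t) ≤ Real.exp (-(2 * ρ * t)) * B x₀ x₀ := by
  set δ : ℕ → ℝ := fun n => 1 / ((n : ℝ) + 1) with hδ
  have hδ0 : ∀ n, 0 < δ n := fun n => by positivity
  have hδlim : Tendsto δ atTop (𝓝 0) := tendsto_one_div_add_atTop_nhds_zero_nat
  choose E E' hE0 hE1 hE2 hE3 hE4 using fun n =>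
    exists_yosida_flow hk hB hsymm hρ hR (hδ0 n) (hsurj _ (hδ0 n))
  have hcontr : ∀ n x t, 0 ≤ t → B (E n t x) (E n t x) ≤ B x x := by
    intro n x t ht
    have h1 := hE3 n x t ht
    have h2 : Real.exp (-(2 * (ρ / (1 + ρ * δ n)) * t)) ≤ 1 := by
      rw [Real.exp_le_one_iff, neg_nonpos]
      have := hδ0 n
      positivity
    nlinarith [form_nonneg hk hB x]
  obtain ⟨C, hC0, hC⟩ : ∃ C : ℝ, 0 ≤ C ∧ ∀ n x t, 0 ≤ t → ‖E n t x‖ ≤ C * ‖x‖ := by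
    -- From k‖Ex‖² ≤ B(Ex, Ex) ≤ B(x, x) ≤ ‖B‖‖x‖².
    refine ⟨√(‖B‖ / k), Real.sqrt_nonneg _, fun n x t ht => ?_⟩
    refine abs_le_of_sq_le_sq' ?_ (by positivity) |>.2
    rw [mul_pow, Real.sq_sqrt (by positivity), div_mul_eq_mul_div, le_div_iff₀ hk]
    have h1 := hcontr n x t ht
    have h2 := hB (E n t x)
    have h3 := (Real.le_norm_self _).trans (B.le_opNorm₂ x x)
    nlinarith
  -- The factor 8 is the bound 4 on the derivatives, doubled by differentiating a quadratic form.
  have hdiff : ∀ n m w t, 0 ≤ t →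
      k * ‖E n t (R w) - E m t (R w)‖ ^ 2 ≤ 8 * (δ n + δ m) * B w w * t := by
    intro n m w t ht
    refine (hB _).trans ?_
    have h1 := le_mul_of_deriv_le (K := 8 * (δ n + δ m) * B w w)
      (fun t => hasDerivAt_form B hsymm ((hE1 n (R w) t).sub (hE1 m (R w) t)))
      (fun t ht => ?_) ht
    · simpa [hE0] using h1
    · have h2 := form_yosida_diff_le hk hB hsymm hρ hR (hδ0 n) (hδ0 m)
        (hE4 n w t ht) (hE4 m w t ht)
      rw [hE2, hE2] at h2
      dsimp only [Pi.sub_apply] at h2 ⊢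
      linarith
  have hcauchy : ∀ T : ℝ, 0 ≤ T → UniformCauchySeqOn (fun n t => E n t x₀) atTop (Icc 0 T) := by
    intro T hT
    rw [Metric.uniformCauchySeqOn_iff]
    intro ε hε
    -- Replacing x₀ by R w costs at most ε/4 in each flow, and the flows from R w differ by at most
    -- ε/2. The denominator has C + 1 since C may vanish.
    obtain ⟨w, hw⟩ := hdense.exists_dist_lt x₀ (ε := ε / (4 * (C + 1))) (by positivity)
    rw [dist_eq_norm] at hw
    set K : ℝ := 8 * B w w * T / k with hK
    have hww := form_nonneg hk hB w
    have hK0 : 0 ≤ K := by positivity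
    obtain ⟨N, hN⟩ := exists_nat_one_div_lt (show 0 < ε ^ 2 / (8 * (K + 1)) by positivity)
    have hmono : ∀ n ≥ N, δ n < ε ^ 2 / (8 * (K + 1)) := fun n hn =>
      (one_div_le_one_div_of_le (by positivity) (by exact_mod_cast Nat.succ_le_succ hn)).trans_lt hN
    refine ⟨N, fun m hm n hn t ht => ?_⟩
    rw [dist_eq_norm]
    have h1 := hC m (x₀ - R w) t ht.1
    have h2 := hC n (x₀ - R w) t ht.1
    have h3 : ‖E m t (R w) - E n t (R w)‖ ≤ ε / 2 := by
      refine abs_le_of_sq_le_sq' ?_ (by positivity) |>.2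
      have h4 := hdiff m n w t ht.1
      have h5 := hmono m hm
      have h6 := hmono n hn
      rw [lt_div_iff₀ (by positivity)] at h5 h6
      have h7 : 8 * (δ m + δ n) * B w w * t ≤ k * ((δ m + δ n) * K) := by
        have : k * ((δ m + δ n) * K) = 8 * (δ m + δ n) * B w w * T := by
          rw [hK]; field_simp
        rw [this]
        have := hδ0 m
        have := hδ0 n
        have := ht.2
        gcongr
      have h8 := le_of_mul_le_mul_left (h4.trans h7) hk
      nlinarith [hδ0 m, hδ0 n]
    have h9 : C * ‖x₀ - R w‖ ≤ ε / 4 := by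
      rw [lt_div_iff₀ (by positivity)] at hw
      nlinarith [norm_nonneg (x₀ - R w)]
    have h10 : C * ‖x₀ - R w‖ < ε / 4 := by
      rw [lt_div_iff₀ (by positivity)] at hw
      rcases (norm_nonneg (x₀ - R w)).eq_or_lt with h | h
      · rw [← h]; simp only [mul_zero]; positivity
      · nlinarith
    have h11 : E m t x₀ - E n t x₀
        = E m t (x₀ - R w) + (E m t (R w) - E n t (R w)) - E n t (x₀ - R w) := by
      simp only [map_sub]; abel
    rw [h11]
    have h12 := norm_sub_le (E m t (x₀ - R w) + (E m t (R w) - E n t (R w))) (E n t (x₀ - R w))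
    have h13 := norm_add_le (E m t (x₀ - R w)) (E m t (R w) - E n t (R w))
    linarith
  have hlim : ∀ t, ∃ y, 0 ≤ t → Tendsto (fun n => E n t x₀) atTop (𝓝 y) := by
    intro t
    rcases le_or_gt 0 t with ht | ht
    · obtain ⟨y, hy⟩ := cauchySeq_tendsto_of_complete
        ((hcauchy t ht).cauchySeq ⟨ht, le_rfl⟩)
      exact ⟨y, fun _ => hy⟩
    · exact ⟨0, fun h => absurd h (not_le.2 ht)⟩
  choose y hy using hlim
  have hycont : ContinuousOn y (Ici 0) := by
    have h1 : ∀ T : ℝ, 0 ≤ T → ContinuousOn y (Icc 0 T) := by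
      intro T hT
      have h2 := (hcauchy T hT).tendstoUniformlyOn_of_tendsto fun t ht => hy t ht.1
      refine h2.continuousOn (Frequently.of_forall fun n t _ => ?_)
      exact (hE1 n x₀ t).continuousAt.continuousWithinAt
    intro t ht
    have h2 := h1 (t + 1) (by linarith [mem_Ici.1 ht]) t ⟨ht, by linarith⟩
    refine h2.mono_of_mem_nhdsWithin ?_
    filter_upwards [self_mem_nhdsWithin, mem_nhdsWithin_of_mem_nhds (Iio_mem_nhds (lt_add_one t))]
      with s hs hs'
    exact ⟨hs, le_of_lt hs'⟩
  have hint : ∀ n t, 0 ≤ t → (R - δ n • ContinuousLinearMap.id ℝ X) (E n t x₀ - x₀)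
      = ∫ s in (0 : ℝ)..t, E n s x₀ := by
    intro n t ht
    have hc : Continuous fun s => E n s x₀ :=
      continuous_iff_continuousAt.2 fun s => (hE1 n x₀ s).continuousAt
    have h1 := intervalIntegral.integral_eq_sub_of_hasDerivAt
      (f := fun s => (R - δ n • ContinuousLinearMap.id ℝ X) (E n s x₀))
      (f' := fun s => E n s x₀) (a := 0) (b := t) (fun s _ => ?_) (hc.intervalIntegrable _ _)
    · rw [h1, hE0, map_sub]
    · have h2 := (R - δ n • ContinuousLinearMap.id ℝ X).hasFDerivAt.comp_hasDerivAt s (hE1 n x₀ s)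
      refine h2.congr_deriv ?_
      exact hE2 n x₀ s
  -- Freezing y at its initial value for negative times makes it continuous on the whole line.
  refine ⟨fun t => y (max t 0), ?_, fun t ht => ?_, fun t ht => ?_⟩
  · exact hycont.comp_continuous (by fun_prop) fun t => mem_Ici.2 (le_max_right _ _)
  · have h1 : Tendsto (fun n => ∫ s in (0 : ℝ)..t, E n s x₀) atTop
        (𝓝 (∫ s in (0 : ℝ)..t, y (max s 0))) := by
      refine intervalIntegral.tendsto_integral_filter_of_dominated_convergence
        (fun _ => C * ‖x₀‖) (Eventually.of_forall fun n => ?_)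
        (Eventually.of_forall fun n => Eventually.of_forall fun s hs => ?_)
        (by simp) (Eventually.of_forall fun s hs => ?_)
      · exact (continuous_iff_continuousAt.2
          fun s => (hE1 n x₀ s).continuousAt).aestronglyMeasurable
      · rw [uIoc_of_le ht] at hs
        exact hC n x₀ s hs.1.le
      · rw [uIoc_of_le ht] at hs
        rw [max_eq_left hs.1.le]
        exact hy s hs.1.le
    have h2 : Tendsto (fun n => (R - δ n • ContinuousLinearMap.id ℝ X) (E n t x₀ - x₀)) atTop
        (𝓝 (R (y t - x₀))) := by
      have h3 := (hy t ht).sub_const x₀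
      have h4 := ((R.continuous.tendsto _).comp h3).sub (hδlim.smul h3)
      simpa using h4
    simp only [max_eq_left ht]
    refine tendsto_nhds_unique h2 ?_
    simpa only [hint _ t ht] using h1
  · simp only [max_eq_left ht]
    have h1 : Tendsto (fun n => B (E n t x₀) (E n t x₀)) atTop (𝓝 (B (y t) (y t))) := by
      have hc : Continuous fun x => B x x := by fun_prop
      exact (hc.tendsto _).comp (hy t ht)
    have h2 : Tendsto (fun n => Real.exp (-(2 * (ρ / (1 + ρ * δ n)) * t)) * B x₀ x₀) atTop
        (𝓝 (Real.exp (-(2 * (ρ / (1 + ρ * 0)) * t)) * B x₀ x₀)) := by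
      have h3 : Tendsto (fun n => ρ / (1 + ρ * δ n)) atTop (𝓝 (ρ / (1 + ρ * 0))) :=
        tendsto_const_nhds.div ((hδlim.const_mul ρ).const_add 1) (by simp)
      exact ((Real.continuous_exp.tendsto _).comp
        (((h3.const_mul 2).mul_const t).neg)).mul_const _
    simp only [mul_zero, add_zero, div_one] at h2
    exact le_of_tendsto_of_tendsto' h1 h2 fun n => hE3 n x₀ t ht

end Generation

/-! ### Mild solutions: uniqueness and construction from the inverse -/

section Mild

variable {X E : Type*} [NormedAddCommGroup X] [NormedSpace ℝ X] [CompleteSpace X]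
  [NormedAddCommGroup E] [NormedSpace ℝ E] [CompleteSpace E]

/-- Uniqueness of mild solutions for operators that are dissipative for some form. -/
theorem IsMildSolution.unique {A : E → E → Prop} {Q : E →L[ℝ] E →L[ℝ] ℝ}
    (hsub : ∀ {y z y' z'}, A y z → A y' z' → A (y - y') (z - z'))
    (hsymm : ∀ x y, Q x y = Q y x) (hdiss : ∀ {y z}, A y z → Q y z ≤ 0)
    (hQ : ∀ {y z}, A y z → Q y y ≤ 0 → y = 0) {Y₀ : E} {Y : ℝ → E}
    (hY : IsMildSolution A Y₀ Y) : IsUniqueMildSolution A Y₀ Y := by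
  refine ⟨hY, fun Z hZ => ?_⟩
  -- Solutions are frozen for negative times so that the primitive of their difference is
  -- differentiable everywhere.
  set D : ℝ → E := fun s => Z (max s 0) - Y (max s 0) with hD
  have hmax : ∀ t : ℝ, max t 0 ∈ Ici (0 : ℝ) := fun t => mem_Ici.2 (le_max_right _ _)
  have hcZ : Continuous fun s => Z (max s 0) := hZ.1.comp_continuous (by fun_prop) hmax
  have hcY : Continuous fun s => Y (max s 0) := hY.1.comp_continuous (by fun_prop) hmax
  have hcD : Continuous D := hcZ.sub hcY
  set y : ℝ → E := fun t => ∫ s in (0 : ℝ)..t, D s with hy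
  have hder : ∀ t, HasDerivAt y (D t) t := fun t =>
    intervalIntegral.integral_hasDerivAt_right (hcD.intervalIntegrable _ _)
      (hcD.stronglyMeasurableAtFilter _ _) hcD.continuousAt
  have hext : ∀ (W : ℝ → E) (t : ℝ), 0 ≤ t →
      ∫ s in (0 : ℝ)..t, W (max s 0) = ∫ s in (0 : ℝ)..t, W s := by
    intro W t ht
    refine intervalIntegral.integral_congr fun s hs => ?_
    rw [uIcc_of_le ht] at hs
    simp only [max_eq_left hs.1]
  have hA : ∀ t, 0 ≤ t → A (y t) (D t) := by
    intro t ht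
    have h1 := hsub (hZ.2 t ht) (hY.2 t ht)
    have h2 : y t = (∫ s in (0 : ℝ)..t, Z s) - ∫ s in (0 : ℝ)..t, Y s := by
      rw [hy, ← hext Z t ht, ← hext Y t ht]
      exact intervalIntegral.integral_sub (hcZ.intervalIntegrable _ _)
        (hcY.intervalIntegrable _ _)
    rw [← h2, sub_sub_sub_cancel_right] at h1
    simpa only [hD, max_eq_left ht] using h1
  -- On [0, ∞), y is a classical solution of y' = A y with y(0) = 0, so Q(y, y) does not increase.
  have hzero : ∀ t, 0 ≤ t → y t = 0 := by
    intro t ht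
    refine hQ (hA t ht) ?_
    have h1 := le_mul_of_deriv_le (K := 0) (fun t => hasDerivAt_form Q hsymm (hder t))
      (fun t ht => by have := hdiss (hA t ht); linarith) ht
    simpa [hy] using h1
  intro t ht
  have h1 : HasDerivWithinAt y (D t) (Ici 0) t := (hder t).hasDerivWithinAt
  have h2 : HasDerivWithinAt y 0 (Ici 0) t :=
    (hasDerivWithinAt_const t (Ici 0) (0 : E)).congr (fun s hs => hzero s hs) (hzero t ht)
  have h3 : D t = 0 := (uniqueDiffOn_Ici 0 t ht).eq_deriv _ h1 h2
  simp only [hD, max_eq_left (mem_Ici.1 ht)] at h3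
  exact sub_eq_zero.1 h3

/-- The map Φ carries the chart space, where R is bounded, to the energy space; `hA` says that R
inverts A from the right. -/
theorem isMildSolution_of_resolvent {A : E → E → Prop} {R : X →L[ℝ] X} (Φ : X →L[ℝ] E)
    (hA : ∀ z, A (Φ (R z)) (Φ z)) {x₀ : X} {Y : ℝ → X} (hY : Continuous Y)
    (h : ∀ t, 0 ≤ t → R (Y t - x₀) = ∫ s in (0 : ℝ)..t, Y s) :
    IsMildSolution A (Φ x₀) (fun t => Φ (Y t)) := by
  refine ⟨(Φ.continuous.comp hY).continuousOn, fun t ht => ?_⟩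
  rw [Φ.intervalIntegral_comp_comm (hY.intervalIntegrable _ _), ← h t ht, ← map_sub]
  exact hA _

end Mild

/-! ### Calculus in H¹(0,1): primitives and traces -/

namespace H1

theorem ext_fn_deriv {u v : H1} (hfn : u.fn = v.fn) (hderiv : u.deriv = v.deriv) :
    u = v := by
  apply Subtype.ext
  apply (WithLp.equiv 2 (L2 × L2)).injective
  exact Prod.ext hfn hderiv

/-- `u ↦ u` as a continuous linear map `H¹ → L²`. -/
noncomputable def fnL : H1 →L[ℝ] L2 :=
  ContinuousLinearMap.fst ℝ L2 L2 ∘L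
    (WithLp.prodContinuousLinearEquiv 2 ℝ L2 L2 : WithLp 2 (L2 × L2) →L[ℝ] L2 × L2) ∘L
      H1Submodule.subtypeL

/-- Weak differentiation as a continuous linear map `H¹ → L²`. -/
noncomputable def derivL : H1 →L[ℝ] L2 :=
  ContinuousLinearMap.snd ℝ L2 L2 ∘L
    (WithLp.prodContinuousLinearEquiv 2 ℝ L2 L2 : WithLp 2 (L2 × L2) →L[ℝ] L2 × L2) ∘L
      H1Submodule.subtypeL

@[simp] theorem fnL_apply (u : H1) : fnL u = u.fn := rfl

@[simp] theorem fn_add (u v : H1) : (u + v).fn = u.fn + v.fn := rfl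
@[simp] theorem fn_sub (u v : H1) : (u - v).fn = u.fn - v.fn := rfl
@[simp] theorem fn_smul (r : ℝ) (u : H1) : (r • u).fn = r • u.fn := rfl
@[simp] theorem deriv_add (u v : H1) : (u + v).deriv = u.deriv + v.deriv := rfl
@[simp] theorem deriv_sub (u v : H1) : (u - v).deriv = u.deriv - v.deriv := rfl
@[simp] theorem deriv_smul (r : ℝ) (u : H1) : (r • u).deriv = r • u.deriv := rfl

theorem norm_fn_le (u : H1) : ‖u.fn‖ ≤ ‖u‖ := by
  have := u.norm_sq
  exact abs_le_of_sq_le_sq' (by nlinarith [sq_nonneg ‖u.deriv‖]) (norm_nonneg _) |>.2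

theorem norm_deriv_le (u : H1) : ‖u.deriv‖ ≤ ‖u‖ := by
  have := u.norm_sq
  exact abs_le_of_sq_le_sq' (by nlinarith [sq_nonneg ‖u.fn‖]) (norm_nonneg _) |>.2

end H1

/-- Functions continuous on `[0,1]` that agree almost everywhere on `(0,1)` are equal. -/
theorem eqOn_of_ae_eq {F G : ℝ → ℝ} (hF : ContinuousOn F (Icc (0 : ℝ) 1))
    (hG : ContinuousOn G (Icc (0 : ℝ) 1)) (h : F =ᵐ[vol01] G) : EqOn F G (Icc 0 1) := by
  have h1 : EqOn F G (Ioo 0 1) :=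
    Measure.eqOn_open_of_ae_eq h isOpen_Ioo (hF.mono Ioo_subset_Icc_self)
      (hG.mono Ioo_subset_Icc_self)
  refine h1.of_subset_closure hF hG Ioo_subset_Icc_self ?_
  rw [closure_Ioo zero_ne_one]

theorem H1.rep_eqOn (u : H1) {F : ℝ → ℝ} (hF : ContinuousOn F (Icc (0 : ℝ) 1))
    (h : u.fn =ᵐ[vol01] F) : EqOn u.rep F (Icc 0 1) :=
  eqOn_of_ae_eq u.rep_continuousOn hF (u.fn_ae_eq_rep.symm.trans h)

theorem H1.rep_add (u v : H1) {x : ℝ} (hx : x ∈ Icc (0 : ℝ) 1) :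
    (u + v).rep x = u.rep x + v.rep x := by
  refine H1.rep_eqOn (u + v) (F := fun x => u.rep x + v.rep x)
    (u.rep_continuousOn.add v.rep_continuousOn) ?_ hx
  filter_upwards [Lp.coeFn_add u.fn v.fn, u.fn_ae_eq_rep, v.fn_ae_eq_rep] with x h1 h2 h3
  rw [H1.fn_add, h1, Pi.add_apply, h2, h3]

theorem H1.rep_smul (r : ℝ) (u : H1) {x : ℝ} (hx : x ∈ Icc (0 : ℝ) 1) :
    (r • u).rep x = r * u.rep x := by
  refine H1.rep_eqOn (r • u) (F := fun x => r * u.rep x)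
    (u.rep_continuousOn.const_mul r) ?_ hx
  filter_upwards [Lp.coeFn_smul r u.fn, u.fn_ae_eq_rep] with x h1 h2
  rw [H1.fn_smul, h1, Pi.smul_apply, h2, smul_eq_mul]

theorem H1.rep_sub (u v : H1) {x : ℝ} (hx : x ∈ Icc (0 : ℝ) 1) :
    (u - v).rep x = u.rep x - v.rep x := by
  have h := H1.rep_add (u - v) v hx
  rw [sub_add_cancel] at h
  linarith

/-- An `L²` function whose primitive vanishes identically is zero. -/
theorem L2_eq_of_primitive {f g : L2}
    (h : ∀ x ∈ Icc (0 : ℝ) 1, ∫ y in (0 : ℝ)..x, f y = ∫ y in (0 : ℝ)..x, g y) : f = g := by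
  have hf := intervalIntegrable_L2 f
  have hg := intervalIntegrable_L2 g
  apply Lp.ext
  refine (ae_restrict_iff' measurableSet_Ioo).2 ?_
  filter_upwards [hf.ae_hasDerivAt_integral, hg.ae_hasDerivAt_integral] with x h1 h2 hx
  have hx' : x ∈ uIcc (0 : ℝ) 1 := by
    rw [uIcc_of_le zero_le_one]; exact Ioo_subset_Icc_self hx
  have h3 := h1 hx' 0 (by simp)
  have h4 := h2 hx' 0 (by simp)
  refine h3.unique (h4.congr_of_eventuallyEq ?_)
  filter_upwards [isOpen_Ioo.mem_nhds hx] with y hy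
  exact h y (Ioo_subset_Icc_self hy)

/-- Equal functions have the same continuous representative, hence their derivatives have the same
primitive. -/
theorem H1.deriv_eq_of_fn_eq {u v : H1} (h : u.fn = v.fn) : u.deriv = v.deriv := by
  have h1 : EqOn u.rep v.rep (Icc 0 1) :=
    u.rep_eqOn v.rep_continuousOn (by rw [h]; exact v.fn_ae_eq_rep)
  refine L2_eq_of_primitive fun x hx => ?_
  have h2 := u.rep_eq hx
  have h3 := v.rep_eq hx
  rw [h1 hx, h1 ⟨le_rfl, zero_le_one⟩] at h2
  linarith

theorem H1.fn_injective : Function.Injective H1.fn := fun _ _ h =>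
  H1.ext_fn_deriv h (H1.deriv_eq_of_fn_eq h)

/-- Bound for the primitive of an `L²` function. -/
theorem abs_primitive_le (g : L2) {x : ℝ} (hx : x ∈ Icc (0 : ℝ) 1) :
    |∫ y in (0 : ℝ)..x, g y| ≤ ‖g‖ := by
  have hind : MemLp ((Ioc 0 x).indicator fun _ => (1 : ℝ)) 2 vol01 :=
    (memLp_const 1).indicator measurableSet_Ioc
  have h1 : ∫ y in (0 : ℝ)..x, g y = inner ℝ (hind.toLp _) g := by
    rw [inner_toLp, intervalIntegral.integral_of_le hx.1, ← integral_indicator measurableSet_Ioc,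
      ← integral_indicator measurableSet_Ioo]
    -- For x = 1 the half-open interval contains the point 1, which the open interval omits.
    have hne : ∀ᵐ y : ℝ, y ≠ 1 := by simp [ae_iff]
    refine integral_congr_ae ?_
    filter_upwards [hne] with y hy
    by_cases h : y ∈ Ioc 0 x
    · have : y ∈ Ioo (0 : ℝ) 1 := ⟨h.1, lt_of_le_of_ne (h.2.trans hx.2) hy⟩
      simp [h, this]
    · by_cases h' : y ∈ Ioo (0 : ℝ) 1 <;> simp [h, h']
  rw [h1]
  refine (abs_real_inner_le_norm _ _).trans ?_
  have h2 : ‖hind.toLp _‖ ≤ 1 := by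
    rw [Lp.norm_toLp]
    refine ENNReal.toReal_le_of_le_ofReal zero_le_one ?_
    refine (eLpNorm_indicator_le _).trans ?_
    rw [eLpNorm_const _ (by norm_num) (by simp)]
    simp
  nlinarith [norm_nonneg g]

theorem norm_le_of_ae_bound {g : L2} {C : ℝ} (hC : 0 ≤ C) (h : ∀ᵐ x ∂vol01, |g x| ≤ C) :
    ‖g‖ ≤ C := by
  have := Lp.norm_le_of_ae_bound (p := 2) (μ := vol01) (f := g) hC h
  refine this.trans ?_
  simp [measureUnivNNReal]

theorem primitive_continuousOn (g : L2) :
    ContinuousOn (fun x => ∫ y in (0 : ℝ)..x, g y) (Icc (0 : ℝ) 1) := by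
  have := ((intervalIntegrable_L2 g).absolutelyContinuousOnInterval_intervalIntegral
    (c := 0) (by simp)).continuousOn
  rwa [uIcc_of_le zero_le_one] at this

theorem memLp_primitive (g : L2) : MemLp (fun x => ∫ y in (0 : ℝ)..x, g y) 2 vol01 := by
  refine MemLp.of_bound ?_ ‖g‖ ?_
  · exact ((primitive_continuousOn g).mono Ioo_subset_Icc_self).aestronglyMeasurable
      measurableSet_Ioo
  · exact (ae_restrict_iff' measurableSet_Ioo).2
      (Eventually.of_forall fun x hx => abs_primitive_le g (Ioo_subset_Icc_self hx))

/-- The primitive `x ↦ ∫₀ˣ g` of an `L²` function as an element of `H¹`. -/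
noncomputable def primFun (g : L2) : H1 :=
  ⟨WithLp.toLp 2 ((memLp_primitive g).toLp _, g), by
    intro φ hφ
    have h := integral_primitive_mul_deriv g hφ
    refine Eq.trans ?_ h
    refine integral_congr_ae ?_
    filter_upwards [(memLp_primitive g).coeFn_toLp] with x hx
    change ((memLp_primitive g).toLp _ : L2) x * _ = _
    rw [hx]⟩

@[simp] theorem primFun_deriv (g : L2) : (primFun g).deriv = g := rfl

theorem primFun_fn (g : L2) : (primFun g).fn =ᵐ[vol01] fun x => ∫ y in (0 : ℝ)..x, g y :=
  (memLp_primitive g).coeFn_toLp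

theorem primFun_rep (g : L2) {x : ℝ} (hx : x ∈ Icc (0 : ℝ) 1) :
    (primFun g).rep x = ∫ y in (0 : ℝ)..x, g y :=
  (primFun g).rep_eqOn (primitive_continuousOn g) (primFun_fn g) hx

theorem norm_primFun_fn_le (g : L2) : ‖(primFun g).fn‖ ≤ ‖g‖ := by
  refine norm_le_of_ae_bound (norm_nonneg _) ?_
  filter_upwards [primFun_fn g, ae_restrict_mem measurableSet_Ioo] with x hx hx'
  rw [hx]
  exact abs_primitive_le g (Ioo_subset_Icc_self hx')

/-- The constant function `1` as an element of `H¹`. -/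
noncomputable def oneH1 : H1 :=
  ⟨WithLp.toLp 2 ((memLp_of_continuous (φ := fun _ => (1 : ℝ)) continuous_const).toLp _, 0), by
    intro φ hφ
    have hφi : ∫ x in Ioo (0 : ℝ) 1, deriv φ x = 0 := by
      rw [← integral_Ioc_eq_integral_Ioo, ← intervalIntegral.integral_of_le zero_le_one,
        intervalIntegral.integral_deriv_eq_sub (fun x _ => (hφ.1.differentiable (by simp)) x)
          (hφ.continuous_deriv.intervalIntegrable _ _)]
      rw [image_eq_zero_of_notMem_tsupport (f := φ) (x := 1) fun hx => by simpa using hφ.2.2 hx,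
        image_eq_zero_of_notMem_tsupport (f := φ) (x := 0) fun hx => by simpa using hφ.2.2 hx,
        sub_zero]
    have h1 : ∫ x in Ioo (0 : ℝ) 1, (0 : L2) x * φ x = 0 := by
      refine integral_eq_zero_of_ae ?_
      filter_upwards [Lp.coeFn_zero ℝ 2 vol01] with x hx
      rw [hx]; simp
    refine Eq.trans ?_ (by rw [show (WithLp.toLp 2
      ((memLp_of_continuous (φ := fun _ => (1 : ℝ)) continuous_const).toLp _, (0 : L2))).snd = 0
      from rfl, h1, neg_zero])
    refine Eq.trans ?_ hφi
    refine integral_congr_ae ?_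
    filter_upwards [(memLp_of_continuous (φ := fun _ => (1 : ℝ)) continuous_const).coeFn_toLp]
      with x hx
    change ((memLp_of_continuous (φ := fun _ => (1 : ℝ)) continuous_const).toLp _ : L2) x * _ = _
    rw [hx, one_mul]⟩

@[simp] theorem oneH1_deriv : oneH1.deriv = 0 := rfl

theorem oneH1_rep {x : ℝ} (hx : x ∈ Icc (0 : ℝ) 1) : oneH1.rep x = 1 :=
  oneH1.rep_eqOn continuousOn_const
    (memLp_of_continuous (φ := fun _ => (1 : ℝ)) continuous_const).coeFn_toLp hx

theorem H1.ext_rep {u v : H1} (h : EqOn u.rep v.rep (Icc 0 1)) : u = v := by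
  refine H1.fn_injective (Lp.ext ?_)
  filter_upwards [u.fn_ae_eq_rep, v.fn_ae_eq_rep, ae_restrict_mem measurableSet_Ioo]
    with x h1 h2 h3
  rw [h1, h2, h (Ioo_subset_Icc_self h3)]

/-- This gives the coordinates (u(0), u') on H¹ in which the stationary problems are solved. -/
theorem H1.eq_add_primFun (u : H1) : u = u.rep 0 • oneH1 + primFun u.deriv := by
  refine H1.ext_rep fun x hx => ?_
  rw [H1.rep_add _ _ hx, H1.rep_smul _ _ hx, oneH1_rep hx, primFun_rep _ hx, u.rep_eq hx, mul_one]

theorem H1.ext_deriv {u v : H1} (h : u.rep 0 = v.rep 0) (h' : u.deriv = v.deriv) : u = v := by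
  rw [u.eq_add_primFun, v.eq_add_primFun, h, h']

theorem norm_oneH1_fn : ‖oneH1.fn‖ = 1 := by
  change ‖((memLp_of_continuous (φ := fun _ => (1 : ℝ)) continuous_const).toLp _ : L2)‖ = 1
  rw [Lp.norm_toLp, eLpNorm_const _ (by norm_num) (by simp)]
  simp

/-- The constant u(0) is u minus the primitive of u', and the constant 1 has norm one in L²(0,1). -/
theorem H1.abs_rep_zero_le (u : H1) : |u.rep 0| ≤ 2 * ‖u‖ := by
  have h1 : u.rep 0 • oneH1.fn = u.fn - (primFun u.deriv).fn := by
    have := congrArg H1.fn u.eq_add_primFun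
    rw [H1.fn_add, H1.fn_smul] at this
    exact (sub_eq_iff_eq_add.2 this).symm
  have h2 : |u.rep 0| = ‖u.fn - (primFun u.deriv).fn‖ := by
    rw [← h1, norm_smul, norm_oneH1_fn, mul_one, Real.norm_eq_abs]
  have h3 := norm_sub_le u.fn (primFun u.deriv).fn
  have h4 := norm_primFun_fn_le u.deriv
  have h5 := u.norm_fn_le
  have h6 := u.norm_deriv_le
  linarith

theorem H1.abs_rep_sub_le (u : H1) {x : ℝ} (hx : x ∈ Icc (0 : ℝ) 1) :
    |u.rep x - u.rep 0| ≤ ‖u.deriv‖ := by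
  rw [u.rep_eq hx, add_sub_cancel_left]
  exact abs_primitive_le _ hx

theorem H1.abs_rep_one_le (u : H1) : |u.rep 1| ≤ 3 * ‖u‖ := by
  have h1 := u.abs_rep_zero_le
  have h2 := u.abs_rep_sub_le (x := 1) (by simp)
  have h3 := u.norm_deriv_le
  have h4 := abs_add_le (u.rep 1 - u.rep 0) (u.rep 0)
  rw [sub_add_cancel] at h4
  linarith

theorem H1.rep_one_sq_le (u : H1) : u.rep 1 ^ 2 ≤ 2 * (u.rep 0 ^ 2 + ‖u.deriv‖ ^ 2) := by
  have h2 := u.abs_rep_sub_le (x := 1) (by simp)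
  have h3 := sq_le_sq' (neg_le_of_abs_le h2) (le_of_abs_le h2)
  nlinarith [sq_nonneg (u.rep 1 - 2 * u.rep 0)]

/-- Poincaré inequality with a boundary value: it lets the heat dissipation control ‖p‖². -/
theorem H1.norm_fn_sq_le (u : H1) : ‖u.fn‖ ^ 2 ≤ 2 * (u.rep 0 ^ 2 + ‖u.deriv‖ ^ 2) := by
  have h1 : ‖u.fn‖ ≤ |u.rep 0| + ‖u.deriv‖ := by
    conv_lhs => rw [u.eq_add_primFun, H1.fn_add, H1.fn_smul]
    refine (norm_add_le _ _).trans ?_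
    rw [norm_smul, norm_oneH1_fn, mul_one, Real.norm_eq_abs]
    linarith [norm_primFun_fn_le u.deriv]
  have h2 : ‖u.fn‖ ^ 2 ≤ (|u.rep 0| + ‖u.deriv‖) ^ 2 := by gcongr
  rw [← sq_abs (u.rep 0)]
  nlinarith [sq_nonneg (|u.rep 0| - ‖u.deriv‖)]

/-- The trace at `0`. -/
noncomputable def trace0 : H1 →L[ℝ] ℝ :=
  LinearMap.mkContinuous
    { toFun := fun u => u.rep 0
      map_add' := fun u v => H1.rep_add u v (by simp)
      map_smul' := fun r u => H1.rep_smul r u (by simp) } 2 H1.abs_rep_zero_le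

/-- The trace at `1`. -/
noncomputable def trace1 : H1 →L[ℝ] ℝ :=
  LinearMap.mkContinuous
    { toFun := fun u => u.rep 1
      map_add' := fun u v => H1.rep_add u v (by simp)
      map_smul' := fun r u => H1.rep_smul r u (by simp) } 3 H1.abs_rep_one_le

theorem primFun_rep_zero (g : L2) : (primFun g).rep 0 = 0 := by
  rw [primFun_rep g (by simp), intervalIntegral.integral_same]

theorem norm_primFun_le (g : L2) : ‖primFun g‖ ≤ 2 * ‖g‖ := by
  refine abs_le_of_sq_le_sq' ?_ (by positivity) |>.2
  have h := norm_primFun_fn_le g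
  rw [H1.norm_sq, primFun_deriv]
  nlinarith [norm_nonneg g, norm_nonneg (primFun g).fn]

/-- The primitive as a continuous linear map `L² → H¹`. -/
noncomputable def primL : L2 →L[ℝ] H1 :=
  LinearMap.mkContinuous
    { toFun := primFun
      map_add' := fun f g => H1.ext_deriv
        (by rw [H1.rep_add _ _ (by simp)]; simp only [primFun_rep_zero, add_zero])
        (by simp)
      map_smul' := fun r g => H1.ext_deriv
        (by rw [H1.rep_smul _ _ (by simp)]; simp only [primFun_rep_zero, mul_zero])
        (by simp) } 2 norm_primFun_le

@[simp] theorem primL_apply (g : L2) : primL g = primFun g := rfl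

/-- `∫₀¹ g` as a continuous linear functional. -/
noncomputable def meanL : L2 →L[ℝ] ℝ := trace1 ∘L primL

theorem H1.rep_one_eq (u : H1) : u.rep 1 = u.rep 0 + meanL u.deriv := by
  conv_lhs => rw [u.eq_add_primFun, H1.rep_add _ _ (by simp), H1.rep_smul _ _ (by simp),
    oneH1_rep (by simp), mul_one]
  rfl

/-! ### Exponential weights and weighted integration by parts -/

theorem memLp_top_exp (r : ℝ) : MemLp (fun x : ℝ => Real.exp (r * x)) ⊤ vol01 := by
  refine memLp_top_of_bound (by fun_prop) (Real.exp |r|) ?_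
  refine (ae_restrict_iff' measurableSet_Ioo).2 (Eventually.of_forall fun x hx => ?_)
  rw [Real.norm_eq_abs, Real.abs_exp, Real.exp_le_exp]
  calc r * x ≤ |r * x| := le_abs_self _
    _ = |r| * |x| := abs_mul _ _
    _ ≤ |r| * 1 := by
      gcongr
      rw [abs_of_pos hx.1]
      exact hx.2.le
    _ = |r| := mul_one _

/-- Multiplication by `x ↦ exp (r x)` on `L²(0,1)`. -/
noncomputable def expMul (r : ℝ) : L2 →L[ℝ] L2 :=
  (ContinuousLinearMap.mul ℝ ℝ).holderL vol01 ⊤ 2 2 ((memLp_top_exp r).toLp _)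

theorem expMul_ae (r : ℝ) (f : L2) :
    expMul r f =ᵐ[vol01] fun x => Real.exp (r * x) * f x := by
  have h := ContinuousLinearMap.coeFn_holder (r := 2) (ContinuousLinearMap.mul ℝ ℝ)
    ((memLp_top_exp r).toLp _) f
  filter_upwards [h, (memLp_top_exp r).coeFn_toLp] with x h1 h2
  refine h1.trans ?_
  rw [h2]
  rfl

theorem inner_L2 (f g : L2) : inner ℝ f g = ∫ x in Ioo (0 : ℝ) 1, f x * g x := by
  rw [L2.inner_def]
  refine integral_congr_ae (Eventually.of_forall fun x => ?_)
  simp [mul_comm]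

theorem integrable_mul_L2 (f g : L2) : IntegrableOn (fun x => f x * g x) (Ioo (0 : ℝ) 1) := by
  refine (L2.integrable_inner (𝕜 := ℝ) f g).congr (Eventually.of_forall fun x => ?_)
  simp [mul_comm]

theorem inner_expMul (r : ℝ) (f g : L2) :
    inner ℝ (expMul r f) g = ∫ x in Ioo (0 : ℝ) 1, Real.exp (r * x) * f x * g x := by
  rw [inner_L2]
  refine integral_congr_ae ?_
  filter_upwards [expMul_ae r f] with x hx
  rw [hx]

theorem integrable_expMul (r : ℝ) (f g : L2) :
    IntegrableOn (fun x => Real.exp (r * x) * f x * g x) (Ioo (0 : ℝ) 1) := by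
  refine (integrable_mul_L2 (expMul r f) g).congr ?_
  filter_upwards [expMul_ae r f] with x hx
  rw [hx]

theorem inner_expMul_comm (r : ℝ) (f g : L2) :
    inner ℝ (expMul r f) g = inner ℝ (expMul r g) f := by
  rw [inner_expMul, inner_expMul]
  refine integral_congr_ae (Eventually.of_forall fun x => ?_)
  ring

/-- Integration by parts in `H¹` with an exponential weight. -/
theorem H1.integral_by_parts_exp (r : ℝ) (f g : H1) :
    inner ℝ (expMul r f.fn) g.deriv + inner ℝ (expMul r g.fn) f.deriv
      = Real.exp r * f.rep 1 * g.rep 1 - f.rep 0 * g.rep 0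
        - r * inner ℝ (expMul r f.fn) g.fn := by
  set F : ℝ → ℝ := fun x => f.rep 0 + ∫ y in (0 : ℝ)..x, f.deriv y with hF
  set G : ℝ → ℝ := fun x => g.rep 0 + ∫ y in (0 : ℝ)..x, g.deriv y with hG
  set W : ℝ → ℝ := fun x => Real.exp (r * x) with hW
  have hac : ∀ u : H1, AbsolutelyContinuousOnInterval
      (fun x => u.rep 0 + ∫ y in (0 : ℝ)..x, u.deriv y) 0 1 := fun u =>
    (((contDiff_const (c := u.rep 0)).contDiffOn (n := 1)).absolutelyContinuousOnInterval).add
      ((intervalIntegrable_L2 u.deriv).absolutelyContinuousOnInterval_intervalIntegral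
        (c := 0) (by simp))
  have hWac : AbsolutelyContinuousOnInterval W 0 1 := by
    have : ContDiff ℝ 1 W := by fun_prop
    exact this.contDiffOn.absolutelyContinuousOnInterval
  have hWd : ∀ x, HasDerivAt W (r * W x) x := by
    intro x
    have h1 : HasDerivAt (fun x => r * x) r x := by simpa using (hasDerivAt_id x).const_mul r
    exact h1.exp.congr_deriv (mul_comm _ _)
  -- The representatives are absolutely continuous, so the product obeys the fundamental theorem of
  -- calculus; almost everywhere their derivatives are the weak ones.
  have key := (hWac.mul (hac f)).integral_deriv_mul_eq_sub (hac g)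
  have e : ∫ x in (0 : ℝ)..1, (_root_.deriv (W * F) x * G x + (W * F) x * _root_.deriv G x)
      = ∫ x in Ioo (0 : ℝ) 1, (r * (W x * f.fn x * g.fn x) + W x * g.fn x * f.deriv x
          + W x * f.fn x * g.deriv x) := by
    rw [intervalIntegral.integral_of_le zero_le_one, integral_Ioc_eq_integral_Ioo]
    refine integral_congr_ae ?_
    have h1 := ae_restrict_of_ae (s := Ioo (0 : ℝ) 1)
      (intervalIntegrable_L2 f.deriv).ae_hasDerivAt_integral
    have h2 := ae_restrict_of_ae (s := Ioo (0 : ℝ) 1)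
      (intervalIntegrable_L2 g.deriv).ae_hasDerivAt_integral
    filter_upwards [h1, h2, f.fn_ae_eq_rep, g.fn_ae_eq_rep, ae_restrict_mem measurableSet_Ioo]
      with x h1 h2 h3 h4 h5
    have h6 : x ∈ uIcc (0 : ℝ) 1 := by
      rw [uIcc_of_le zero_le_one]; exact Ioo_subset_Icc_self h5
    have hFd : HasDerivAt F (f.deriv x) x := (h1 h6 0 (by simp)).const_add _
    have hGd : HasDerivAt G (g.deriv x) x := (h2 h6 0 (by simp)).const_add _
    rw [((hWd x).mul hFd).deriv, hGd.deriv, h3, h4, f.rep_eq (Ioo_subset_Icc_self h5),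
      g.rep_eq (Ioo_subset_Icc_self h5)]
    simp only [Pi.mul_apply, hF, hG]
    ring
  have e2 : ∫ x in Ioo (0 : ℝ) 1, (r * (W x * f.fn x * g.fn x) + W x * g.fn x * f.deriv x
          + W x * f.fn x * g.deriv x) = r * inner ℝ (expMul r f.fn) g.fn
          + inner ℝ (expMul r g.fn) f.deriv + inner ℝ (expMul r f.fn) g.deriv := by
    rw [inner_expMul, inner_expMul, inner_expMul, ← integral_const_mul, ← integral_add,
      ← integral_add]
    · exact ((integrable_expMul r f.fn g.fn).const_mul r).add (integrable_expMul r g.fn f.deriv)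
    · exact integrable_expMul r f.fn g.deriv
    · exact (integrable_expMul r f.fn g.fn).const_mul r
    · exact integrable_expMul r g.fn f.deriv
  have hF1 := f.rep_eq (x := 1) (by simp)
  have hG1 := g.rep_eq (x := 1) (by simp)
  have key' := e.symm.trans key
  rw [e2] at key'
  simp only [Pi.mul_apply, hW, mul_one, mul_zero, Real.exp_zero, one_mul,
    intervalIntegral.integral_same, add_zero] at key'
  rw [← hF1, ← hG1] at key'
  linarith

theorem expMul_zero (f : L2) : expMul 0 f = f := by
  apply Lp.ext
  filter_upwards [expMul_ae 0 f] with x hx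
  rw [hx]
  simp

/-- Integration by parts in `H¹`. -/
theorem H1.integral_by_parts (f g : H1) :
    inner ℝ f.fn g.deriv + inner ℝ g.fn f.deriv = f.rep 1 * g.rep 1 - f.rep 0 * g.rep 0 := by
  have h := H1.integral_by_parts_exp 0 f g
  simpa [expMul_zero] using h

/-- The weighted energy of the wave equation controls both components. -/
theorem norm_sq_le_wave {μ : ℝ} (hμ : 0 ≤ μ) (g v : L2) :
    ‖g‖ ^ 2 ≤ Real.cosh μ / 2 * (inner ℝ (expMul μ (v + g)) (v + g)
      + inner ℝ (expMul (-μ) (v - g)) (v - g)) := by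
  rw [← real_inner_self_eq_norm_sq, inner_L2, inner_expMul, inner_expMul,
    ← integral_add (integrable_expMul _ _ _) (integrable_expMul _ _ _), ← integral_const_mul]
  refine integral_mono_ae (integrable_mul_L2 g g)
    (((integrable_expMul _ _ _).add (integrable_expMul _ _ _)).const_mul _) ?_
  filter_upwards [Lp.coeFn_add v g, Lp.coeFn_sub v g, ae_restrict_mem measurableSet_Ioo]
    with x h1 h2 h3
  simp only [h1, h2, Pi.add_apply, Pi.sub_apply, neg_mul]
  have h4 : Real.cosh (μ * x) ≤ Real.cosh μ := by
    rw [Real.cosh_le_cosh, abs_of_nonneg (by nlinarith [h3.1]), abs_of_nonneg hμ]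
    nlinarith [h3.1, h3.2]
  have h5 : Real.exp (μ * x) * Real.exp (-(μ * x)) = 1 := by
    rw [← Real.exp_add]; simp
  have hp := Real.exp_pos (μ * x)
  have hq := Real.exp_pos (-(μ * x))
  rw [Real.cosh_eq] at h4
  set P := Real.exp (μ * x)
  set Q := Real.exp (-(μ * x))
  -- Completing the square in v with PQ = 1. Afterwards P + Q = 2 cosh(μx) is bounded by 2 cosh μ.
  have h6 : 4 * (g x * g x) ≤ (P + Q) * (P * (v x + g x) * (v x + g x)
      + Q * (v x - g x) * (v x - g x)) := by
    have : (P + Q) * (P * (v x + g x) * (v x + g x) + Q * (v x - g x) * (v x - g x))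
        - 4 * (g x * g x) = (P * (v x + g x) + Q * (v x - g x)) ^ 2
          + (P * Q - 1) * 4 * (g x * g x) := by ring
    rw [h5] at this
    nlinarith [sq_nonneg (P * (v x + g x) + Q * (v x - g x))]
  have h7 : 0 ≤ P * (v x + g x) * (v x + g x) + Q * (v x - g x) * (v x - g x) := by
    have := mul_nonneg hp.le (mul_self_nonneg (v x + g x))
    have := mul_nonneg hq.le (mul_self_nonneg (v x - g x))
    nlinarith
  nlinarith

/-- The generation theorem on a space isomorphic to a Hilbert space. -/
theorem exists_solution_of_form {X H : Type*} [NormedAddCommGroup X] [NormedSpace ℝ X]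
    [CompleteSpace X] [NormedAddCommGroup H] [InnerProductSpace ℝ H] [CompleteSpace H]
    (e : X ≃L[ℝ] H) {B : X →L[ℝ] X →L[ℝ] ℝ} {R : X →L[ℝ] X} {k ρ : ℝ} (hk : 0 < k)
    (hB : ∀ x, k * ‖x‖ ^ 2 ≤ B x x) (hsymm : ∀ x y, B x y = B y x) (hρ : 0 < ρ)
    (hR : ∀ z, B (R z) z ≤ -(ρ * B (R z) (R z))) (hinj : ∀ z, R z = 0 → z = 0) (x₀ : X) :
    ∃ Y : ℝ → X, Continuous Y ∧
      (∀ t, 0 ≤ t → R (Y t - x₀) = ∫ s in (0 : ℝ)..t, Y s) ∧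
      ∀ t, 0 ≤ t → B (Y t) (Y t) ≤ Real.exp (-(2 * ρ * t)) * B x₀ x₀ := by
  refine exists_solution hk hB hsymm hρ hR (fun δ hδ => ?_)
    (denseRange_of_form e B hk hB hsymm R hinj hρ hR) x₀
  -- Since B(Rz, z) ≤ 0, subtracting δ makes the operator strictly dissipative with constant δ.
  refine surjective_of_form e B hk hB _ hδ fun z => ?_
  have h1 := hR z
  have h2 := form_nonneg hk hB (R z)
  simp only [sub_apply, smul_apply, ContinuousLinearMap.id_apply, map_sub, map_smul, smul_eq_mul]
  nlinarith [mul_nonneg hρ.le h2]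

/-! ### The weighted wave energy and its dissipation -/

/-- The inner product of `L²(0,1)` as a continuous bilinear form. -/
noncomputable def innerL : L2 →L[ℝ] L2 →L[ℝ] ℝ :=
  LinearMap.mkContinuous₂ (innerₗ L2) 1 fun f g => by
    simpa using abs_real_inner_le_norm f g

@[simp] theorem innerL_apply (f g : L2) : innerL f g = inner ℝ f g := rfl

/-- The weighted form `∫ e^{μx} (v + g) (v' + g') + e^{-μx} (v - g) (v' - g')`. -/
noncomputable def waveForm (μ : ℝ) : (L2 × L2) →L[ℝ] (L2 × L2) →L[ℝ] ℝ :=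
  innerL.bilinearComp
      (expMul μ ∘L (ContinuousLinearMap.snd ℝ L2 L2 + ContinuousLinearMap.fst ℝ L2 L2))
      (ContinuousLinearMap.snd ℝ L2 L2 + ContinuousLinearMap.fst ℝ L2 L2)
    + innerL.bilinearComp
      (expMul (-μ) ∘L (ContinuousLinearMap.snd ℝ L2 L2 - ContinuousLinearMap.fst ℝ L2 L2))
      (ContinuousLinearMap.snd ℝ L2 L2 - ContinuousLinearMap.fst ℝ L2 L2)

theorem waveForm_apply (μ : ℝ) (y z : L2 × L2) :
    waveForm μ y z = inner ℝ (expMul μ (y.2 + y.1)) (z.2 + z.1)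
      + inner ℝ (expMul (-μ) (y.2 - y.1)) (z.2 - z.1) := rfl

theorem waveForm_symm (μ : ℝ) (y z : L2 × L2) : waveForm μ y z = waveForm μ z y := by
  rw [waveForm_apply, waveForm_apply, inner_expMul_comm, inner_expMul_comm (-μ)]

theorem norm_fst_sq_le_waveForm {μ : ℝ} (hμ : 0 ≤ μ) (y : L2 × L2) :
    ‖y.1‖ ^ 2 ≤ Real.cosh μ / 2 * waveForm μ y y :=
  norm_sq_le_wave hμ y.1 y.2

/-- Exchanging g and v only changes the sign of v - g. -/
theorem norm_snd_sq_le_waveForm {μ : ℝ} (hμ : 0 ≤ μ) (y : L2 × L2) :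
    ‖y.2‖ ^ 2 ≤ Real.cosh μ / 2 * waveForm μ y y := by
  have h := norm_sq_le_wave hμ y.2 y.1
  rw [add_comm y.1 y.2, ← neg_sub y.2 y.1, map_neg, inner_neg_neg] at h
  exact h

/-- The product norm is a maximum, so the two component bounds need not be added. -/
theorem waveForm_coercive {μ : ℝ} (hμ : 0 ≤ μ) (y : L2 × L2) :
    2 / Real.cosh μ * ‖y‖ ^ 2 ≤ waveForm μ y y := by
  have h1 := norm_fst_sq_le_waveForm hμ y
  have h2 := norm_snd_sq_le_waveForm hμ y
  have hc := Real.cosh_pos μ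
  rw [div_mul_eq_mul_div, div_le_iff₀ hc]
  rcases max_choice ‖y.1‖ ‖y.2‖ with h | h <;> rw [Prod.norm_def, h] <;> linarith

/-- Energy identity for the wave equation. -/
theorem waveForm_energy (μ : ℝ) {w ux : H1} (h0 : w.rep 0 = 0) :
    waveForm μ (ux.fn, w.fn) (w.deriv, ux.deriv)
      = (Real.exp μ * (w.rep 1 + ux.rep 1) ^ 2 - Real.exp (-μ) * (w.rep 1 - ux.rep 1) ^ 2) / 2
        - μ / 2 * waveForm μ (ux.fn, w.fn) (ux.fn, w.fn) := by
  -- The Riemann invariants v ± u_x travel with speeds ∓1, and both weights produce damping. At x =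
  -- 0 both weights are 1 and v = 0, so the boundary terms cancel there.
  have h1 := H1.integral_by_parts_exp μ (w + ux) (w + ux)
  have h2 := H1.integral_by_parts_exp (-μ) (w - ux) (w - ux)
  simp only [H1.fn_add, H1.fn_sub, H1.deriv_add, H1.deriv_sub] at h1 h2
  rw [H1.rep_add _ _ (by simp), H1.rep_add _ _ (by simp), h0] at h1
  rw [H1.rep_sub _ _ (by simp), H1.rep_sub _ _ (by simp), h0] at h2
  rw [waveForm_apply, waveForm_apply]
  dsimp only
  rw [add_comm ux.deriv w.deriv, ← neg_sub w.deriv ux.deriv, inner_neg_right]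
  linarith

/-- Absorption of the boundary term. -/
theorem boundary_le {P Q a w q : ℝ} (hP : 0 < P) (hQ : 0 < Q)
    (h : 2 * P * (1 - a) ^ 2 ≤ Q * (1 + a) ^ 2) :
    P * (w + (-a * w + q)) ^ 2 - Q * (w - (-a * w + q)) ^ 2 ≤ 3 * (P + Q) * q ^ 2 := by
  -- With X = (1 - a)w and Y = (1 + a)w, these squares say (X + q)² ≤ (3/2)X² + 3q² and -(Y - q)² ≤
  -- -(3/4)Y² + 3q². The factor 2 in `h`, which is the √2 of `muStar`, is exactly what cancels the
  -- w² terms.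
  have h1 := mul_nonneg hP.le (sq_nonneg ((1 - a) * w - 2 * q))
  have h2 := mul_nonneg hQ.le (sq_nonneg ((1 + a) * w - 4 * q))
  have h3 := mul_le_mul_of_nonneg_right h (sq_nonneg w)
  nlinarith

/-- The input q is left free: it will be (bd/c) u(1) in the reduced system and b p(0) in the coupled
one. -/
theorem waveForm_dissipation {μ a q : ℝ}
    (h : 2 * Real.exp μ * (1 - a) ^ 2 ≤ Real.exp (-μ) * (1 + a) ^ 2)
    {w ux : H1} (h0 : w.rep 0 = 0) (h1 : ux.rep 1 = -a * w.rep 1 + q) :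
    waveForm μ (ux.fn, w.fn) (w.deriv, ux.deriv)
      ≤ 3 * Real.cosh μ * q ^ 2 - μ / 2 * waveForm μ (ux.fn, w.fn) (ux.fn, w.fn) := by
  rw [waveForm_energy μ h0, h1]
  have := boundary_le (w := w.rep 1) (q := q) (Real.exp_pos μ) (Real.exp_pos (-μ)) h
  rw [Real.cosh_eq]
  linarith

/-- `L² × L²` with its Hilbert space structure. -/
noncomputable def hilbertEquiv₂ : (L2 × L2) ≃L[ℝ] WithLp 2 (L2 × L2) :=
  (WithLp.prodContinuousLinearEquiv 2 ℝ L2 L2).symm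

/-- `L² × L² × L²` with its Hilbert space structure. -/
noncomputable def hilbertEquiv₃ : (L2 × L2 × L2) ≃L[ℝ] WithLp 2 (L2 × WithLp 2 (L2 × L2)) :=
  ((ContinuousLinearEquiv.refl ℝ L2).prodCongr hilbertEquiv₂).trans
    (WithLp.prodContinuousLinearEquiv 2 ℝ L2 (WithLp 2 (L2 × L2))).symm

/-! ### Numerical consequences of the parameter conditions -/

section Parameters

variable {a b c d μ : ℝ}

/-- This is μ ≤ μ*, exponentiated and squared. That a is positive and differs from 1 keeps the
argument of the logarithm positive. -/
theorem boundary_condition (hμa : μ ≤ muStar a) (hi : a ∈ Set.Icc eta⁻¹ eta \ {1}) :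
    2 * Real.exp μ * (1 - a) ^ 2 ≤ Real.exp (-μ) * (1 + a) ^ 2 := by
  have h3 : (1 : ℝ) < √3 := by
    rw [Real.lt_sqrt zero_le_one]; norm_num
  have heta : 0 < eta := div_pos (by linarith) (by linarith)
  have ha : 0 < a := (inv_pos.2 heta).trans_le hi.1.1
  have ha1 : a ≠ 1 := fun h => hi.2 (by simp [h])
  have h1 : 0 < |1 - a| := abs_pos.2 (sub_ne_zero.2 ha1.symm)
  have h2 : 0 < |1 + a| := abs_pos.2 (by linarith)
  have hs : 0 < √2 * |1 - a| := by positivity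
  have h4 : Real.exp μ ≤ |1 + a| / (√2 * |1 - a|) := by
    rw [← Real.exp_log (div_pos h2 hs)]
    exact Real.exp_le_exp.2 hμa
  rw [le_div_iff₀ hs] at h4
  have h5 : (Real.exp μ * (√2 * |1 - a|)) ^ 2 ≤ |1 + a| ^ 2 := by gcongr
  rw [mul_pow, mul_pow, sq_abs, sq_abs, Real.sq_sqrt (by norm_num)] at h5
  have h6 : Real.exp μ * Real.exp (-μ) = 1 := by rw [← Real.exp_add]; simp
  have h7 := mul_le_mul_of_nonneg_left h5 (Real.exp_pos (-μ)).le
  calc 2 * Real.exp μ * (1 - a) ^ 2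
      = (Real.exp μ * Real.exp (-μ)) * (2 * Real.exp μ * (1 - a) ^ 2) := by rw [h6, one_mul]
    _ = Real.exp (-μ) * (Real.exp μ ^ 2 * (2 * (1 - a) ^ 2)) := by ring
    _ ≤ _ := h7

/-- Use π > 3 and drop the sinh part of F. -/
theorem cosh_mul_sq_le (hμ : 0 < μ) (h2 : (Real.pi ^ 2 + 2) / 4 + Fmu μ * b ^ 2 ≤ c) :
    11 / 4 + 10 * (Real.cosh μ * b ^ 2) ≤ c := by
  have h1 := Real.pi_gt_three
  have h3 := Real.sinh_pos_iff.2 hμ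
  unfold Fmu at h2
  nlinarith [mul_nonneg h3.le (sq_nonneg b)]

theorem sq_le_of_abs_le_sqrt (hμ : 0 < μ) (h3 : |d| ≤ √(μ * Real.exp (-μ))) :
    d ^ 2 ≤ μ * Real.exp (-μ) := by
  rw [← sq_abs, ← Real.sq_sqrt (show 0 ≤ μ * Real.exp (-μ) by positivity)]
  gcongr

/-- Because e^{-μ} cosh μ = (1 + e^{-2μ})/2 ≤ 1. -/
theorem sq_mul_cosh_le (hμ : 0 < μ) (hd : d ^ 2 ≤ μ * Real.exp (-μ)) :
    d ^ 2 * Real.cosh μ ≤ μ := by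
  have h1 : Real.exp (-μ) * Real.exp μ = 1 := by rw [← Real.exp_add]; simp
  have h2 : Real.exp (-μ) ≤ 1 := Real.exp_le_one_iff.2 (by linarith)
  have h4 := Real.exp_pos (-μ)
  have h3 : Real.exp (-μ) * Real.cosh μ ≤ 1 := by
    rw [Real.cosh_eq]
    nlinarith
  have h5 := mul_le_mul_of_nonneg_right hd (Real.cosh_pos μ).le
  nlinarith

/-- Group the numerator as (b² cosh μ)(d² cosh μ) ≤ (c/10) μ; dividing by c² leaves μ/(10c), and c ≥
2. -/
theorem cosh_mul_coupling_le (hμ : 0 < μ) (hb : 11 / 4 + 10 * (Real.cosh μ * b ^ 2) ≤ c)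
    (hd : d ^ 2 ≤ μ * Real.exp (-μ)) :
    Real.cosh μ ^ 2 * (b * d / c) ^ 2 ≤ μ / 20 := by
  have h1 := sq_mul_cosh_le hμ hd
  have hc := Real.cosh_pos μ
  have h2 : 0 ≤ Real.cosh μ * b ^ 2 := by positivity
  have hc0 : 0 < c := by linarith
  rw [div_pow, mul_div_assoc', div_le_iff₀ (by positivity)]
  have h4 : (Real.cosh μ * b ^ 2) * (d ^ 2 * Real.cosh μ) ≤ c / 10 * μ :=
    mul_le_mul (by linarith) h1 (by positivity) (by positivity)
  nlinarith [mul_pos hμ hc0]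

/-- The stationary problems are solved by dividing by c - bd, or by 1 - bd/c. The bound follows from
b² ≤ c/10, d² ≤ 1 and 2bd ≤ b² + d². -/
theorem coupling_lt_one (hμ : 0 < μ) (hb : 11 / 4 + 10 * (Real.cosh μ * b ^ 2) ≤ c)
    (hd : d ^ 2 ≤ μ * Real.exp (-μ)) : b * d < c := by
  have hc := Real.one_le_cosh μ
  have h1 : 10 * b ^ 2 ≤ c := by nlinarith [sq_nonneg b]
  have h2 : μ * Real.exp (-μ) ≤ 1 := by
    rw [Real.exp_neg, ← div_eq_mul_inv, div_le_one (Real.exp_pos μ)]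
    linarith [Real.add_one_le_exp μ]
  nlinarith [sq_nonneg (b - d), mul_nonneg (sq_nonneg b) (sub_nonneg.2 hc)]

end Parameters

/-! ### Functions given by their value at 0 and their derivative -/

theorem H1.rep_zero_left {x : ℝ} (hx : x ∈ Icc (0 : ℝ) 1) : (0 : H1).rep x = 0 := by
  have := H1.rep_smul 0 (0 : H1) hx
  simpa using this

@[simp] theorem H1.fn_zero : (0 : H1).fn = 0 := rfl

/-- The element of `H¹` with value `s` at `0` and derivative `g`, depending linearly on `z`. -/
noncomputable def affineL {X : Type*} [NormedAddCommGroup X] [NormedSpace ℝ X] (s : X →L[ℝ] ℝ)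
    (g : X →L[ℝ] L2) : X →L[ℝ] H1 :=
  s.smulRight oneH1 + primL ∘L g

section Affine

variable {X : Type*} [NormedAddCommGroup X] [NormedSpace ℝ X] (s : X →L[ℝ] ℝ) (g : X →L[ℝ] L2)

@[simp] theorem affineL_deriv (z : X) : (affineL s g z).deriv = g z := by
  change (s z • oneH1 + primFun (g z)).deriv = g z
  simp

@[simp] theorem affineL_rep_zero (z : X) : (affineL s g z).rep 0 = s z := by
  change (s z • oneH1 + primFun (g z)).rep 0 = s z
  rw [H1.rep_add _ _ (by simp), H1.rep_smul _ _ (by simp), oneH1_rep (by simp), primFun_rep_zero]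
  ring

theorem affineL_rep_one (z : X) : (affineL s g z).rep 1 = s z + meanL (g z) := by
  rw [H1.rep_one_eq, affineL_rep_zero, affineL_deriv]

end Affine

/-! ### The boundary-layer system -/

theorem layerOp_sub {c : ℝ} {y z y' z' : L2} (h : layerOp c y z) (h' : layerOp c y' z') :
    layerOp c (y - y') (z - z') := by
  obtain ⟨q, px, e1, e2, e3, e4, e5⟩ := h
  obtain ⟨q', px', f1, f2, f3, f4, f5⟩ := h'
  refine ⟨q - q', px - px', by simp [e1, f1], by simp [e2, f2], ?_, ?_, by simp [e5, f5]⟩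
  · rw [H1.rep_sub _ _ (by simp), H1.rep_sub _ _ (by simp), e3, f3]; ring
  · rw [H1.rep_sub _ _ (by simp), e4, f4, sub_zero]

/-- The L² energy serves uniqueness only; existence and decay use the H¹ energy. -/
theorem layerOp_inner_nonpos {c : ℝ} (hc : 0 ≤ c) {y z : L2} (h : layerOp c y z) :
    innerL y z ≤ 0 := by
  obtain ⟨q, px, rfl, e2, e3, e4, rfl⟩ := h
  have h1 := H1.integral_by_parts q px
  rw [e2, ← e2, real_inner_self_eq_norm_sq, e3, e4] at h1
  rw [innerL_apply]
  nlinarith [sq_nonneg ‖px.fn‖, mul_nonneg hc (sq_nonneg (q.rep 0))]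

/-- The energy form of the boundary-layer system. -/
noncomputable def layerForm (c : ℝ) : H1 →L[ℝ] H1 →L[ℝ] ℝ :=
  innerL.bilinearComp H1.derivL H1.derivL
    + c • (ContinuousLinearMap.mul ℝ ℝ).bilinearComp trace0 trace0

theorem layerForm_apply (c : ℝ) (y z : H1) :
    layerForm c y z = inner ℝ y.deriv z.deriv + c * (y.rep 0 * z.rep 0) := rfl

theorem layerForm_symm (c : ℝ) (y z : H1) : layerForm c y z = layerForm c z y := by
  rw [layerForm_apply, layerForm_apply, real_inner_comm, mul_comm (y.rep 0)]

theorem norm_fn_sq_le_layerForm {c : ℝ} (hc : 1 ≤ c) (y : H1) :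
    ‖y.fn‖ ^ 2 ≤ 2 * layerForm c y y := by
  have h := y.norm_fn_sq_le
  rw [layerForm_apply, real_inner_self_eq_norm_sq]
  nlinarith [sq_nonneg (y.rep 0)]

theorem layerForm_coercive {c : ℝ} (hc : 1 ≤ c) (y : H1) :
    1 / 3 * ‖y‖ ^ 2 ≤ layerForm c y y := by
  have h := norm_fn_sq_le_layerForm hc y
  have h1 : ‖y.deriv‖ ^ 2 ≤ layerForm c y y := by
    rw [layerForm_apply, real_inner_self_eq_norm_sq]
    nlinarith [mul_self_nonneg (y.rep 0)]
  rw [H1.norm_sq]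
  linarith

theorem layerForm_le {c : ℝ} (hc : 0 ≤ c) (y : H1) :
    layerForm c y y ≤ (1 + 4 * c) * ‖y‖ ^ 2 := by
  have h1 := y.abs_rep_zero_le
  have h2 := y.norm_deriv_le
  have h3 : y.rep 0 ^ 2 ≤ (2 * ‖y‖) ^ 2 := sq_le_sq' (neg_le_of_abs_le h1) (le_of_abs_le h1)
  have h4 : ‖y.deriv‖ ^ 2 ≤ ‖y‖ ^ 2 := by gcongr
  rw [layerForm_apply, real_inner_self_eq_norm_sq]
  nlinarith

/-- The derivative of the solution of `y'' = z`, `y'(0) = c y(0)`, `y'(1) = 0`. -/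
noncomputable def layerFlux : H1 →L[ℝ] H1 := affineL (-(meanL ∘L H1.fnL)) H1.fnL

/-- The solution of `y'' = z`, `y'(0) = c y(0)`, `y'(1) = 0`. -/
noncomputable def layerInv (c : ℝ) : H1 →L[ℝ] H1 :=
  affineL (-(c⁻¹ • (meanL ∘L H1.fnL))) (H1.fnL ∘L layerFlux)

theorem layerOp_layerInv {c : ℝ} (hc : 0 < c) (z : H1) :
    layerOp c (layerInv c z).fn z.fn := by
  refine ⟨layerInv c z, layerFlux z, rfl, ?_, ?_, ?_, ?_⟩
  · simp [layerInv]
  · simp [layerInv, layerFlux, hc.ne']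
  · rw [layerFlux, affineL_rep_one]
    simp
  · simp [layerFlux]

theorem layerInv_eq_zero {c : ℝ} {z : H1} (h : layerInv c z = 0) : z = 0 := by
  have h1 : (layerInv c z).deriv = 0 := by rw [h]; rfl
  have h2 : layerFlux z = 0 := H1.fn_injective (by simpa [layerInv] using h1)
  have h3 : (layerFlux z).deriv = 0 := by rw [h2]; rfl
  exact H1.fn_injective (by simpa [layerFlux] using h3)

/-- Put y = R z, so that y'' = z. Integrating by parts, B(y, z) = -‖z‖² and B(y, y) = -⟨y, z⟩.
Expanding ‖y + 2z‖² ≥ 0 and using ‖y‖² ≤ 2 B(y, y) gives B(y, y) ≤ 2‖z‖². -/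
theorem layerForm_dissipation {c : ℝ} (hc : 1 ≤ c) (z : H1) :
    layerForm c (layerInv c z) z
      ≤ -(1 / 2 * layerForm c (layerInv c z) (layerInv c z)) := by
  have hop := layerOp_layerInv (zero_lt_one.trans_le hc) z
  obtain ⟨q, px, e1, e2, e3, e4, e5⟩ := hop
  have e1 := H1.fn_injective e1
  subst e1
  have h1 := H1.integral_by_parts px z
  have h2 := H1.integral_by_parts px (layerInv c z)
  rw [e3, e4, ← e5] at h1 h2
  have h3 := norm_fn_sq_le_layerForm hc (layerInv c z)
  rw [layerForm_apply, layerForm_apply, ← e2] at *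
  have h4 : 0 ≤ ‖(layerInv c z).fn + (2 : ℝ) • z.fn‖ ^ 2 := sq_nonneg _
  rw [norm_add_sq_real, inner_smul_right, norm_smul, Real.norm_eq_abs, mul_pow, sq_abs] at h4
  rw [real_inner_self_eq_norm_sq] at h1
  linarith

/-- The boundary-layer equation is well posed in `H¹`, with exponential decay. -/
theorem exists_layer_solution {c : ℝ} (hc : 1 ≤ c) (p₀ : H1) :
    ∃ p : ℝ → H1, Continuous p ∧
      IsUniqueMildSolution (layerOp c) p₀.fn (fun t => (p t).fn) ∧
      ∀ t, 0 ≤ t → layerForm c (p t) (p t) ≤ Real.exp (-t) * layerForm c p₀ p₀ := by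
  have hc0 : 0 < c := zero_lt_one.trans_le hc
  obtain ⟨p, h1, h2, h3⟩ := exists_solution_of_form (ContinuousLinearEquiv.refl ℝ H1)
    (k := 1 / 3) (ρ := 1 / 2) (by norm_num) (layerForm_coercive hc) (layerForm_symm c)
    (by norm_num) (layerForm_dissipation hc) (fun _ => layerInv_eq_zero) p₀
  refine ⟨p, h1, ?_, fun t ht => ?_⟩
  · refine IsMildSolution.unique (Q := innerL) layerOp_sub
      (fun x y => by rw [innerL_apply, innerL_apply, real_inner_comm])
      (layerOp_inner_nonpos hc0.le) (fun {y z} _ h => ?_)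
      (isMildSolution_of_resolvent (A := layerOp c) H1.fnL (layerOp_layerInv hc0) h1 h2)
    rw [innerL_apply, real_inner_self_eq_norm_sq] at h
    exact norm_eq_zero.1 (pow_eq_zero_iff two_ne_zero |>.1 (le_antisymm h (sq_nonneg _)))
  · have := h3 t ht
    rwa [show -(2 * (1 / 2 : ℝ) * t) = -t by ring] at this

/-! ### The reduced system -/

/-- `(u, v) ↦ (u_x, v)`. -/
noncomputable def reducedChart : H1 × L2 →L[ℝ] L2 × L2 :=
  (H1.derivL ∘L ContinuousLinearMap.fst ℝ H1 L2).prod (ContinuousLinearMap.snd ℝ H1 L2)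

/-- `(g, v) ↦ (u, v)` with `u_x = g` and `u(0) = 0`. -/
noncomputable def reducedLift : L2 × L2 →L[ℝ] H1 × L2 :=
  (primL ∘L ContinuousLinearMap.fst ℝ L2 L2).prod (ContinuousLinearMap.snd ℝ L2 L2)

theorem reducedChart_apply (y : H1 × L2) : reducedChart y = (y.1.deriv, y.2) := rfl
theorem reducedLift_apply (x : L2 × L2) : reducedLift x = (primFun x.1, x.2) := rfl

theorem reducedChart_reducedLift (x : L2 × L2) : reducedChart (reducedLift x) = x := rfl

theorem primFun_deriv_eq {u : H1} (h : u.rep 0 = 0) : primFun u.deriv = u :=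
  H1.ext_deriv (by rw [primFun_rep_zero, h]) rfl

theorem reducedOp_sub {a b c d : ℝ} {y z y' z' : H1 × L2} (h : reducedOp a b c d y z)
    (h' : reducedOp a b c d y' z') : reducedOp a b c d (y - y') (z - z') := by
  obtain ⟨w, ux, e1, e2, e3, e4, e5, e6⟩ := h
  obtain ⟨w', ux', f1, f2, f3, f4, f5, f6⟩ := h'
  refine ⟨w - w', ux - ux', by simp [e1, f1], by simp [e2, f2], ?_, ?_, ?_, by simp [e6, f6]⟩
  · rw [Prod.fst_sub, H1.rep_sub _ _ (by simp), e3, f3, sub_zero]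
  · rw [H1.rep_sub _ _ (by simp), e4, f4, sub_zero]
  · rw [Prod.fst_sub, H1.rep_sub _ _ (by simp), H1.rep_sub _ _ (by simp),
      H1.rep_sub _ _ (by simp), e5, f5]
    ring

section Reduced

variable {a b c d μ : ℝ}

theorem rep_one_sq_le_of_zero {u : H1} (h : u.rep 0 = 0) : u.rep 1 ^ 2 ≤ ‖u.deriv‖ ^ 2 := by
  have h2 := u.abs_rep_sub_le (x := 1) (by simp)
  rw [h, sub_zero] at h2
  exact sq_le_sq' (neg_le_of_abs_le h2) (le_of_abs_le h2)

/-- The input (bd/c) u(1) is controlled by ‖u_x‖, hence by the form itself. It costs at most 3μ/40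
of the damping μ/2. -/
theorem reducedOp_dissipation (hμ : 0 < μ)
    (ha : 2 * Real.exp μ * (1 - a) ^ 2 ≤ Real.exp (-μ) * (1 + a) ^ 2)
    (hb : 11 / 4 + 10 * (Real.cosh μ * b ^ 2) ≤ c) (hd : d ^ 2 ≤ μ * Real.exp (-μ))
    {y z : H1 × L2} (h : reducedOp a b c d y z) :
    waveForm μ (reducedChart y) (reducedChart z)
      ≤ -(μ / 8 * waveForm μ (reducedChart y) (reducedChart y)) := by
  obtain ⟨w, ux, e1, e2, e3, e4, e5, rfl⟩ := h
  have h1 := waveForm_dissipation ha e4 e5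
  have h2 := cosh_mul_coupling_le hμ hb hd
  have h3 := rep_one_sq_le_of_zero e3
  have h4 := norm_fst_sq_le_waveForm hμ.le (ux.fn, w.fn)
  rw [reducedChart_apply, reducedChart_apply]
  dsimp only at *
  rw [← e1, ← e2] at *
  set W := waveForm μ (ux.fn, w.fn) (ux.fn, w.fn)
  have hc := Real.cosh_pos μ
  have hW : 0 ≤ W := by
    by_contra hneg
    push Not at hneg
    nlinarith [sq_nonneg ‖ux.fn‖]
  have h5 : Real.cosh μ * (b * d / c * y.1.rep 1) ^ 2 ≤ μ / 40 * W := by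
    have h6 : y.1.rep 1 ^ 2 ≤ Real.cosh μ / 2 * W := h3.trans h4
    calc Real.cosh μ * (b * d / c * y.1.rep 1) ^ 2
        = Real.cosh μ * (b * d / c) ^ 2 * y.1.rep 1 ^ 2 := by ring
      _ ≤ Real.cosh μ * (b * d / c) ^ 2 * (Real.cosh μ / 2 * W) := by gcongr
      _ = Real.cosh μ ^ 2 * (b * d / c) ^ 2 * (W / 2) := by ring
      _ ≤ μ / 20 * (W / 2) := by gcongr
      _ = μ / 40 * W := by ring
  nlinarith [mul_nonneg hμ.le hW]

/-- The value at `0` of the derivative of the solution of the stationary reduced problem. -/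
noncomputable def reducedFluxZero (a b c d : ℝ) : L2 × L2 →L[ℝ] ℝ :=
  (1 - b * d / c)⁻¹ •
    ((b * d / c) • (meanL ∘L H1.fnL ∘L primL ∘L ContinuousLinearMap.snd ℝ L2 L2)
      - meanL ∘L ContinuousLinearMap.snd ℝ L2 L2
      - a • (meanL ∘L ContinuousLinearMap.fst ℝ L2 L2))

/-- The derivative of the solution of the stationary reduced problem. -/
noncomputable def reducedFlux (a b c d : ℝ) : L2 × L2 →L[ℝ] H1 :=
  affineL (reducedFluxZero a b c d) (ContinuousLinearMap.snd ℝ L2 L2)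

/-- The inverse of the reduced operator. -/
noncomputable def reducedInv (a b c d : ℝ) : L2 × L2 →L[ℝ] L2 × L2 :=
  (H1.fnL ∘L reducedFlux a b c d).prod (H1.fnL ∘L primL ∘L ContinuousLinearMap.fst ℝ L2 L2)

theorem meanL_oneH1 : meanL oneH1.fn = 1 := by
  change (primFun oneH1.fn).rep 1 = 1
  rw [primFun_rep _ (by simp), intervalIntegral.integral_of_le zero_le_one,
    integral_Ioc_eq_integral_Ioo]
  rw [integral_congr_ae (g := fun _ => (1 : ℝ))]
  · simp
  · exact (memLp_of_continuous (φ := fun _ => (1 : ℝ)) continuous_const).coeFn_toLp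

theorem meanL_affineL {X : Type*} [NormedAddCommGroup X] [NormedSpace ℝ X] (s : X →L[ℝ] ℝ)
    (g : X →L[ℝ] L2) (z : X) :
    meanL (affineL s g z).fn = s z + meanL (primFun (g z)).fn := by
  change meanL (s z • oneH1 + primFun (g z)).fn = _
  rw [H1.fn_add, H1.fn_smul, map_add, map_smul, meanL_oneH1, smul_eq_mul, mul_one]

theorem primFun_rep_one (g : L2) : (primFun g).rep 1 = meanL g := rfl

/-- With κ = bd/c and s = u_x(0), the condition at x = 1 is s + ∫z₂ = -a ∫z₁ + κ u(1), where u(1) is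
s plus the double integral of z₂: a linear equation for s with coefficient 1 - κ. -/
theorem reducedOp_reducedInv (hc : b * d / c ≠ 1) (z : L2 × L2) :
    reducedOp a b c d (reducedLift (reducedInv a b c d z)) (reducedLift z) := by
  refine ⟨primFun z.1, reducedFlux a b c d z, rfl, rfl, primFun_rep_zero _, primFun_rep_zero _,
    ?_, ?_⟩
  · have h1 : (reducedLift (reducedInv a b c d z)).1.rep 1
        = meanL (reducedFlux a b c d z).fn := rfl
    rw [h1, reducedFlux, meanL_affineL, affineL_rep_one, primFun_rep_one]
    simp only [reducedFluxZero, smul_apply, sub_apply, ContinuousLinearMap.comp_apply,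
      ContinuousLinearMap.coe_snd', ContinuousLinearMap.coe_fst', smul_eq_mul, primL_apply,
      H1.fnL_apply]
    have h2 : 1 - b * d / c ≠ 0 := sub_ne_zero.2 hc.symm
    generalize b * d / c = κ at *
    field_simp
    ring
  · rw [reducedLift_apply, reducedFlux, affineL_deriv]
    rfl

theorem reducedInv_eq_zero {z : L2 × L2} (h : reducedInv a b c d z = 0) : z = 0 := by
  have e1 : (reducedFlux a b c d z).fn = 0 := congrArg Prod.fst h
  have e2 : (primFun z.1).fn = 0 := congrArg Prod.snd h
  have h1 : reducedFlux a b c d z = 0 := H1.fn_injective e1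
  have h2 : primFun z.1 = 0 := H1.fn_injective e2
  have h3 : (reducedFlux a b c d z).deriv = 0 := by rw [h1]; rfl
  have h4 : (primFun z.1).deriv = 0 := by rw [h2]; rfl
  rw [reducedFlux, affineL_deriv] at h3
  exact Prod.ext h4 h3

/-- Mild solutions of the reduced system exist, are unique and decay exponentially. -/
theorem exists_reduced_solution (hμ : 0 < μ)
    (ha : 2 * Real.exp μ * (1 - a) ^ 2 ≤ Real.exp (-μ) * (1 + a) ^ 2)
    (hb : 11 / 4 + 10 * (Real.cosh μ * b ^ 2) ≤ c) (hd : d ^ 2 ≤ μ * Real.exp (-μ))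
    {u₀ : H1} (h0 : u₀.rep 0 = 0) (u₁ : L2) :
    ∃ Y : ℝ → L2 × L2, Continuous Y ∧
      IsUniqueMildSolution (reducedOp a b c d) (u₀, u₁) (fun t => (primFun (Y t).1, (Y t).2)) ∧
      ∀ t, 0 ≤ t → waveForm μ (Y t) (Y t)
        ≤ Real.exp (-(μ / 4 * t)) * waveForm μ (u₀.deriv, u₁) (u₀.deriv, u₁) := by
  have hc0 : 0 < c := by
    have : 0 ≤ Real.cosh μ * b ^ 2 := by have := Real.cosh_pos μ; positivity
    linarith
  have hc : b * d / c ≠ 1 := by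
    have := coupling_lt_one hμ hb hd
    exact (div_lt_one hc0 |>.2 this).ne
  have hcoer := waveForm_coercive hμ.le
  have hk : 0 < 2 / Real.cosh μ := by have := Real.cosh_pos μ; positivity
  have hdiss : ∀ {y z}, reducedOp a b c d y z → waveForm μ (reducedChart y) (reducedChart z)
      ≤ -(μ / 8 * waveForm μ (reducedChart y) (reducedChart y)) :=
    reducedOp_dissipation hμ ha hb hd
  obtain ⟨Y, h1, h2, h3⟩ := exists_solution_of_form hilbertEquiv₂ (R := reducedInv a b c d)
    (ρ := μ / 8) hk hcoer (waveForm_symm μ) (by positivity)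
    (fun z => by
      have := hdiss (reducedOp_reducedInv hc z)
      rwa [reducedChart_reducedLift, reducedChart_reducedLift] at this) (fun _ => reducedInv_eq_zero)
    (u₀.deriv, u₁)
  refine ⟨Y, h1, ?_, fun t ht => ?_⟩
  · have hm := isMildSolution_of_resolvent (A := reducedOp a b c d) reducedLift
      (reducedOp_reducedInv hc) h1 h2
    rw [reducedLift_apply, primFun_deriv_eq h0] at hm
    refine hm.unique (Q := (waveForm μ).bilinearComp reducedChart reducedChart) reducedOp_sub
      (fun x y => waveForm_symm μ _ _) (fun {y z} h => ?_) (fun {y z} h h' => ?_)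
    · have h4 := form_nonneg hk hcoer (reducedChart y)
      have h5 := hdiss h
      change waveForm μ (reducedChart y) (reducedChart z) ≤ 0
      nlinarith
    -- The pulled-back form sees only u_x and v; the condition u(0) = 0 in the domain recovers u.
    · have h4 := eq_zero_of_form_nonpos hk hcoer h'
      obtain ⟨w, ux, e1, e2, e3, -⟩ := h
      have h5 : y.1.deriv = 0 := congrArg Prod.fst h4
      have h6 : y.2 = 0 := congrArg Prod.snd h4
      exact Prod.ext (H1.ext_deriv (e3.trans (H1.rep_zero_left (by simp)).symm) h5) h6
  · have := h3 t ht
    rwa [show -(2 * (μ / 8) * t) = -(μ / 4 * t) by ring] at this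

end Reduced

/-! ### The coupled system -/

/-- `(u, v, p) ↦ (u_x, v, p)`. -/
noncomputable def fullChart : H1 × L2 × L2 →L[ℝ] L2 × L2 × L2 :=
  (H1.derivL ∘L ContinuousLinearMap.fst ℝ H1 (L2 × L2)).prod
    (ContinuousLinearMap.snd ℝ H1 (L2 × L2))

/-- `(g, v, p) ↦ (u, v, p)` with `u_x = g` and `u(0) = 0`. -/
noncomputable def fullLift : L2 × L2 × L2 →L[ℝ] H1 × L2 × L2 :=
  (primL ∘L ContinuousLinearMap.fst ℝ L2 (L2 × L2)).prod
    (ContinuousLinearMap.snd ℝ L2 (L2 × L2))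

theorem fullChart_apply (y : H1 × L2 × L2) : fullChart y = (y.1.deriv, y.2.1, y.2.2) := rfl
theorem fullLift_apply (x : L2 × L2 × L2) : fullLift x = (primFun x.1, x.2.1, x.2.2) := rfl
theorem fullChart_fullLift (x : L2 × L2 × L2) : fullChart (fullLift x) = x := rfl

/-- `(g, v, p) ↦ (g, v)`. -/
noncomputable def waveComp : L2 × L2 × L2 →L[ℝ] L2 × L2 :=
  (ContinuousLinearMap.fst ℝ L2 (L2 × L2)).prod
    (ContinuousLinearMap.fst ℝ L2 L2 ∘L ContinuousLinearMap.snd ℝ L2 (L2 × L2))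

/-- `(g, v, p) ↦ p`. -/
noncomputable def heatComp : L2 × L2 × L2 →L[ℝ] L2 :=
  ContinuousLinearMap.snd ℝ L2 L2 ∘L ContinuousLinearMap.snd ℝ L2 (L2 × L2)

/-- The Lyapunov form of the coupled system. -/
noncomputable def fullForm (μ ε : ℝ) : (L2 × L2 × L2) →L[ℝ] (L2 × L2 × L2) →L[ℝ] ℝ :=
  (waveForm μ).bilinearComp waveComp waveComp + ε • innerL.bilinearComp heatComp heatComp

theorem fullForm_apply (μ ε : ℝ) (y z : L2 × L2 × L2) :
    fullForm μ ε y z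
      = waveForm μ (y.1, y.2.1) (z.1, z.2.1) + ε * inner ℝ y.2.2 z.2.2 := rfl

theorem fullForm_symm (μ ε : ℝ) (y z : L2 × L2 × L2) : fullForm μ ε y z = fullForm μ ε z y := by
  rw [fullForm_apply, fullForm_apply, waveForm_symm, real_inner_comm]

theorem waveForm_nonneg {μ : ℝ} (hμ : 0 ≤ μ) (y : L2 × L2) : 0 ≤ waveForm μ y y :=
  form_nonneg (by have := Real.cosh_pos μ; positivity : 0 < 2 / Real.cosh μ)
    (waveForm_coercive hμ) y

theorem waveForm_le_fullForm {μ ε : ℝ} (hε : 0 ≤ ε) (y : L2 × L2 × L2) :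
    waveForm μ (y.1, y.2.1) (y.1, y.2.1) ≤ fullForm μ ε y y := by
  rw [fullForm_apply, real_inner_self_eq_norm_sq]
  nlinarith [mul_nonneg hε (sq_nonneg ‖y.2.2‖)]

theorem heat_le_fullForm {μ ε : ℝ} (hμ : 0 ≤ μ) (y : L2 × L2 × L2) :
    ε * ‖y.2.2‖ ^ 2 ≤ fullForm μ ε y y := by
  rw [fullForm_apply, real_inner_self_eq_norm_sq]
  linarith [waveForm_nonneg hμ (y.1, y.2.1)]

/-- This constant degenerates as ε → 0 and serves well-posedness at fixed ε only. Estimates uniform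
in ε use the two preceding bounds. -/
theorem fullForm_coercive {μ ε : ℝ} (hμ : 0 ≤ μ) (hε : 0 ≤ ε) (y : L2 × L2 × L2) :
    min (2 / Real.cosh μ) ε * ‖y‖ ^ 2 ≤ fullForm μ ε y y := by
  have h1 := waveForm_coercive hμ (y.1, y.2.1)
  have h2 := waveForm_le_fullForm (μ := μ) hε y
  have h3 := heat_le_fullForm (ε := ε) hμ y
  have hc : 0 ≤ min (2 / Real.cosh μ) ε :=
    le_min (by have := Real.cosh_pos μ; positivity) hε
  have hn : ‖y‖ = max ‖(y.1, y.2.1)‖ ‖y.2.2‖ := by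
    rw [Prod.norm_def, Prod.norm_def, Prod.norm_def, max_assoc]
  rcases max_choice ‖(y.1, y.2.1)‖ ‖y.2.2‖ with h | h
  · rw [hn, h]
    refine le_trans ?_ (h1.trans h2)
    gcongr
    exact min_le_left _ _
  · rw [hn, h]
    refine le_trans ?_ h3
    gcongr
    exact min_le_right _ _

theorem fullOp_sub {a b c d ε : ℝ} {y z y' z' : H1 × L2 × L2} (h : fullOp a b c d ε y z)
    (h' : fullOp a b c d ε y' z') : fullOp a b c d ε (y - y') (z - z') := by
  obtain ⟨w, q, ux, px, e1, e2, e3, e4, e5, e6, e7, e8, e9, e10⟩ := h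
  obtain ⟨w', q', ux', px', f1, f2, f3, f4, f5, f6, f7, f8, f9, f10⟩ := h'
  refine ⟨w - w', q - q', ux - ux', px - px', by simp [e1, f1], by simp [e2, f2],
    by simp [e3, f3], by simp [e4, f4], ?_, ?_, ?_, ?_, ?_, by simp [e10, f10, smul_sub]⟩
  · rw [Prod.fst_sub, H1.rep_sub _ _ (by simp), e5, f5, sub_zero]
  · rw [H1.rep_sub _ _ (by simp), e6, f6, sub_zero]
  · rw [H1.rep_sub _ _ (by simp), H1.rep_sub _ _ (by simp),
      H1.rep_sub _ _ (by simp), e7, f7]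
    ring
  · rw [H1.rep_sub _ _ (by simp), H1.rep_sub _ _ (by simp), e8, f8]
    ring
  · rw [Prod.fst_sub, H1.rep_sub _ _ (by simp), H1.rep_sub _ _ (by simp), e9, f9]
    ring

section Full

variable {a b c d μ ε : ℝ}

/-- The weight ε cancels the factor ε⁻¹ of the heat equation, so the rate does not depend on ε. -/
theorem fullOp_dissipation (hμ : 0 < μ)
    (ha : 2 * Real.exp μ * (1 - a) ^ 2 ≤ Real.exp (-μ) * (1 + a) ^ 2)
    (hb : 11 / 4 + 10 * (Real.cosh μ * b ^ 2) ≤ c) (hd : d ^ 2 ≤ μ * Real.exp (-μ))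
    (hε : 0 < ε) (hεμ : ε * μ ≤ 1)
    {y z : H1 × L2 × L2} (h : fullOp a b c d ε y z) :
    fullForm μ ε (fullChart y) (fullChart z)
      ≤ -(μ / 8 * fullForm μ ε (fullChart y) (fullChart y)) := by
  obtain ⟨w, q, ux, px, e1, e2, e3, e4, e5, e6, e7, e8, e9, rfl⟩ := h
  have h1 := waveForm_dissipation ha e6 e7
  have h2 := sq_mul_cosh_le hμ hd
  have h3 := rep_one_sq_le_of_zero e5
  have h4 := norm_fst_sq_le_waveForm hμ.le (ux.fn, w.fn)
  have h5 := H1.integral_by_parts q px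
  have h6 := q.rep_one_sq_le
  have h7 := q.norm_fn_sq_le
  rw [← e4, real_inner_self_eq_norm_sq, e8, e9] at h5
  rw [← e4] at h6 h7
  rw [fullForm_apply, fullForm_apply, fullChart_apply, fullChart_apply]
  dsimp only at *
  rw [← e1, ← e2, ← e3, inner_smul_right, mul_inv_cancel_left₀ hε.ne',
    real_inner_self_eq_norm_sq]
  rw [← e3] at h3
  have hW := waveForm_nonneg hμ.le (ux.fn, w.fn)
  set W := waveForm μ (ux.fn, w.fn) (ux.fn, w.fn)
  set p0 := q.rep 0
  set p1 := q.rep 1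
  set U := y.1.rep 1
  have h8 : d ^ 2 * U ^ 2 ≤ μ / 2 * W := by
    calc d ^ 2 * U ^ 2 ≤ d ^ 2 * (Real.cosh μ / 2 * W) := by
          gcongr; exact h3.trans h4
      _ = d ^ 2 * Real.cosh μ * (W / 2) := by ring
      _ ≤ μ * (W / 2) := by gcongr
      _ = μ / 2 * W := by ring
  -- As p1² ≤ 2(p0² + ‖p_x‖²), the weight 3/8 spends 3/4 of the dissipation ‖p_x‖²; the remaining
  -- 1/4 pays for (μ/8) ε‖p‖² by Poincaré and εμ ≤ 1. The other term costs μ/3 of the damping μ/2,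
  -- leaving μ/6 ≥ μ/8.
  have h9 : p1 * (d * U) ≤ 3 / 8 * p1 ^ 2 + 2 / 3 * (d ^ 2 * U ^ 2) := by
    nlinarith [sq_nonneg (3 * p1 - 4 * (d * U))]
  have h10 : ε * μ * ‖q.fn‖ ^ 2 ≤ ‖q.fn‖ ^ 2 :=
    mul_le_of_le_one_left (sq_nonneg _) hεμ
  have h11 : (11 / 4 + 10 * (Real.cosh μ * b ^ 2)) * p0 ^ 2 ≤ c * p0 ^ 2 := by gcongr
  have h12 : 0 ≤ Real.cosh μ * b ^ 2 * p0 ^ 2 := by have := Real.cosh_pos μ; positivity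
  nlinarith [mul_nonneg hμ.le hW, sq_nonneg p0, sq_nonneg ‖px.fn‖]

/-- The integral of the solution of `y'' = z`, `y(0) = 0`, `y'(0) = 0`. -/
noncomputable def doubleMean : L2 →L[ℝ] ℝ := meanL ∘L H1.fnL ∘L primL

/-- The value `p(0)` for the stationary coupled problem. -/
noncomputable def fullHeatZero (a b c d ε : ℝ) : L2 × L2 × L2 →L[ℝ] ℝ :=
  (c - b * d)⁻¹ •
    (d • (doubleMean ∘L ContinuousLinearMap.snd ℝ L2 L2 ∘L waveComp
        - a • (meanL ∘L ContinuousLinearMap.fst ℝ L2 L2 ∘L waveComp)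
        - meanL ∘L ContinuousLinearMap.snd ℝ L2 L2 ∘L waveComp)
      - ε • (meanL ∘L heatComp))

/-- The value `u_x(0)` for the stationary coupled problem. -/
noncomputable def fullFluxZero (a b c d ε : ℝ) : L2 × L2 × L2 →L[ℝ] ℝ :=
  b • fullHeatZero a b c d ε
    - a • (meanL ∘L ContinuousLinearMap.fst ℝ L2 L2 ∘L waveComp)
    - meanL ∘L ContinuousLinearMap.snd ℝ L2 L2 ∘L waveComp

/-- `u_x` for the stationary coupled problem. -/
noncomputable def fullFlux (a b c d ε : ℝ) : L2 × L2 × L2 →L[ℝ] H1 :=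
  affineL (fullFluxZero a b c d ε) (ContinuousLinearMap.snd ℝ L2 L2 ∘L waveComp)

/-- `p_x` for the stationary coupled problem. -/
noncomputable def fullHeatFlux (a b c d ε : ℝ) : L2 × L2 × L2 →L[ℝ] H1 :=
  affineL (c • fullHeatZero a b c d ε) (ε • heatComp)

/-- `p` for the stationary coupled problem. -/
noncomputable def fullHeat (a b c d ε : ℝ) : L2 × L2 × L2 →L[ℝ] H1 :=
  affineL (fullHeatZero a b c d ε) (H1.fnL ∘L fullHeatFlux a b c d ε)

/-- The inverse of the coupled operator. -/
noncomputable def fullInv (a b c d ε : ℝ) : L2 × L2 × L2 →L[ℝ] L2 × L2 × L2 :=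
  (H1.fnL ∘L fullFlux a b c d ε).prod
    ((H1.fnL ∘L primL ∘L ContinuousLinearMap.fst ℝ L2 (L2 × L2)).prod
      (H1.fnL ∘L fullHeat a b c d ε))

/-- The condition at x = 1 on u expresses u_x(0) through p(0). Substituting it into p_x(1) = d u(1)
leaves one linear equation for p(0), with coefficient c - bd. -/
theorem fullOp_fullInv (hc : b * d < c) (hε : 0 < ε) (z : L2 × L2 × L2) :
    fullOp a b c d ε (fullLift (fullInv a b c d ε z)) (fullLift z) := by
  have hU : (fullLift (fullInv a b c d ε z)).1.rep 1
      = fullFluxZero a b c d ε z + doubleMean z.2.1 := by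
    have h1 : (fullLift (fullInv a b c d ε z)).1.rep 1
      = meanL (fullFlux a b c d ε z).fn := rfl
    rw [h1, fullFlux, meanL_affineL]
    rfl
  have hs : fullFluxZero a b c d ε z
      = b * fullHeatZero a b c d ε z - a * meanL z.1 - meanL z.2.1 := rfl
  have hp : fullHeatZero a b c d ε z = (c - b * d)⁻¹ *
      (d * (doubleMean z.2.1 - a * meanL z.1 - meanL z.2.1) - ε * meanL z.2.2) := rfl
  refine ⟨primFun z.1, fullHeat a b c d ε z, fullFlux a b c d ε z, fullHeatFlux a b c d ε z,
    rfl, rfl, rfl, ?_, primFun_rep_zero _, primFun_rep_zero _, ?_, ?_, ?_, ?_⟩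
  · rw [fullHeat, affineL_deriv]
    rfl
  · rw [fullFlux, affineL_rep_one, fullHeat, affineL_rep_zero, hs, primFun_rep_one]
    change _ - meanL z.2.1 + meanL z.2.1 = _
    ring
  · rw [fullHeat, affineL_rep_zero, fullHeatFlux, affineL_rep_zero]
    rfl
  · rw [fullHeatFlux, affineL_rep_one, hU, hs]
    have h1 : meanL ((ε • heatComp) z) = ε * meanL z.2.2 := by
      change meanL (ε • z.2.2) = _
      rw [map_smul, smul_eq_mul]
    have h2 : (c • fullHeatZero a b c d ε) z = c * fullHeatZero a b c d ε z := rfl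
    have h3 : (c - b * d) * fullHeatZero a b c d ε z
        = d * (doubleMean z.2.1 - a * meanL z.1 - meanL z.2.1) - ε * meanL z.2.2 := by
      rw [hp, mul_inv_cancel_left₀ (sub_pos.2 hc).ne']
    rw [h1, h2]
    linarith
  · rw [fullFlux, affineL_deriv, fullHeatFlux, affineL_deriv, fullLift_apply]
    have h1 : (ε • heatComp) z = ε • z.2.2 := rfl
    rw [h1, smul_smul, inv_mul_cancel₀ hε.ne', one_smul]
    rfl

theorem fullInv_eq_zero (hε : 0 < ε) {z : L2 × L2 × L2} (h : fullInv a b c d ε z = 0) :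
    z = 0 := by
  have e1 : (fullFlux a b c d ε z).fn = 0 := congrArg Prod.fst h
  have e2 : (primFun z.1).fn = 0 := congrArg (fun x => x.2.1) h
  have e3 : (fullHeat a b c d ε z).fn = 0 := congrArg (fun x => x.2.2) h
  have h1 : fullFlux a b c d ε z = 0 := H1.fn_injective e1
  have h2 : primFun z.1 = 0 := H1.fn_injective e2
  have h3 : fullHeat a b c d ε z = 0 := H1.fn_injective e3
  have g1 : (fullFlux a b c d ε z).deriv = 0 := by rw [h1]; rfl
  have g2 : (primFun z.1).deriv = 0 := by rw [h2]; rfl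
  have g3 : (fullHeat a b c d ε z).deriv = 0 := by rw [h3]; rfl
  rw [fullFlux, affineL_deriv] at g1
  rw [fullHeat, affineL_deriv] at g3
  have h4 : fullHeatFlux a b c d ε z = 0 := H1.fn_injective g3
  have g4 : (fullHeatFlux a b c d ε z).deriv = 0 := by rw [h4]; rfl
  rw [fullHeatFlux, affineL_deriv] at g4
  have g5 : ε • z.2.2 = 0 := g4
  exact Prod.ext g2 (Prod.ext g1 ((smul_eq_zero.1 g5).resolve_left hε.ne'))

/-- Mild solutions of the coupled system exist, are unique and decay exponentially, uniformly
in `ε`. -/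
theorem exists_full_solution (hμ : 0 < μ)
    (ha : 2 * Real.exp μ * (1 - a) ^ 2 ≤ Real.exp (-μ) * (1 + a) ^ 2)
    (hb : 11 / 4 + 10 * (Real.cosh μ * b ^ 2) ≤ c) (hd : d ^ 2 ≤ μ * Real.exp (-μ))
    (hε : 0 < ε) (hεμ : ε * μ ≤ 1)
    {u₀ : H1} (h0 : u₀.rep 0 = 0) (u₁ p₀ : L2) :
    ∃ Y : ℝ → L2 × L2 × L2, Continuous Y ∧
      IsUniqueMildSolution (fullOp a b c d ε) (u₀, u₁, p₀)
        (fun t => (primFun (Y t).1, (Y t).2.1, (Y t).2.2)) ∧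
      ∀ t, 0 ≤ t → fullForm μ ε (Y t) (Y t)
        ≤ Real.exp (-(μ / 4 * t)) *
          fullForm μ ε (u₀.deriv, u₁, p₀) (u₀.deriv, u₁, p₀) := by
  have hc := coupling_lt_one hμ hb hd
  have hcoer := fullForm_coercive hμ.le hε.le
  have hk : 0 < min (2 / Real.cosh μ) ε :=
    lt_min (by have := Real.cosh_pos μ; positivity) hε
  have hdiss : ∀ {y z}, fullOp a b c d ε y z → fullForm μ ε (fullChart y) (fullChart z)
      ≤ -(μ / 8 * fullForm μ ε (fullChart y) (fullChart y)) :=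
    fullOp_dissipation hμ ha hb hd hε hεμ
  obtain ⟨Y, h1, h2, h3⟩ := exists_solution_of_form hilbertEquiv₃ (R := fullInv a b c d ε)
    (ρ := μ / 8) hk hcoer (fullForm_symm μ ε) (by positivity)
    (fun z => by
      have := hdiss (fullOp_fullInv hc hε z)
      rwa [fullChart_fullLift, fullChart_fullLift] at this) (fun _ => fullInv_eq_zero hε)
    (u₀.deriv, u₁, p₀)
  refine ⟨Y, h1, ?_, fun t ht => ?_⟩
  · have hm := isMildSolution_of_resolvent (A := fullOp a b c d ε) fullLift
      (fullOp_fullInv hc hε) h1 h2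
    rw [fullLift_apply, primFun_deriv_eq h0] at hm
    refine hm.unique (Q := (fullForm μ ε).bilinearComp fullChart fullChart) fullOp_sub
      (fun x y => fullForm_symm μ ε _ _) (fun {y z} h => ?_) (fun {y z} h h' => ?_)
    · have h4 := form_nonneg hk hcoer (fullChart y)
      have h5 := hdiss h
      change fullForm μ ε (fullChart y) (fullChart z) ≤ 0
      nlinarith
    · have h4 := eq_zero_of_form_nonpos hk hcoer h'
      obtain ⟨w, q, ux, px, e1, e2, e3, e4, e5, -⟩ := h
      have h5 : y.1.deriv = 0 := congrArg Prod.fst h4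
      have h6 : y.2 = 0 := congrArg Prod.snd h4
      exact Prod.ext (H1.ext_deriv (e5.trans (H1.rep_zero_left (by simp)).symm) h5) h6
  · have := h3 t ht
    rwa [show -(2 * (μ / 8) * t) = -(μ / 4 * t) by ring] at this

end Full

/-! ### Time derivatives and estimates uniform in ε -/

/-- If the first component of the operator is the second component of the state, then the first
component of a mild solution is differentiable in time. -/
theorem IsMildSolution.hasDerivWithinAt_fn {E : Type*} [NormedAddCommGroup E] [NormedSpace ℝ E]
    [CompleteSpace E] {A : E → E → Prop} {Y₀ : E} {Y : ℝ → E} (hY : IsMildSolution A Y₀ Y)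
    (hc : Continuous Y) (π : E →L[ℝ] H1) (σ : E →L[ℝ] L2)
    (hA : ∀ {y z}, A y z → (π z).fn = σ y) {t : ℝ} (ht : 0 ≤ t) :
    HasDerivWithinAt (fun s => (π (Y s)).fn) (σ (Y t)) (Ici 0) t := by
  have h1 : HasDerivAt (fun t => ∫ s in (0 : ℝ)..t, Y s) (Y t) t :=
    intervalIntegral.integral_hasDerivAt_right (hc.intervalIntegrable _ _)
      (hc.stronglyMeasurableAtFilter _ _) hc.continuousAt
  have h2 : HasDerivAt (fun t => (π Y₀).fn + σ (∫ s in (0 : ℝ)..t, Y s)) (σ (Y t)) t :=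
    (σ.hasFDerivAt.comp_hasDerivAt t h1).const_add _
  have h3 : ∀ s, 0 ≤ s → (π (Y s)).fn = (π Y₀).fn + σ (∫ s in (0 : ℝ)..s, Y s) := by
    intro s hs
    rw [← hA (hY.2 s hs), map_sub, H1.fn_sub, add_sub_cancel]
  exact h2.hasDerivWithinAt.congr (fun s hs => h3 s hs) (h3 t ht)

theorem norm_le_of_sq_le_exp {x A e E : ℝ} (he : 0 ≤ e) (hE : 0 ≤ E)
    (h : x ^ 2 ≤ A * (e ^ 2 * E ^ 2)) : x ≤ √A * e * E := by
  -- For negative A the hypothesis forces x = 0, consistently with the default value √A = 0.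
  rcases le_or_gt 0 A with hA | hA
  · refine le_trans (le_abs_self x) (abs_le_of_sq_le_sq ?_ (by positivity))
    rw [mul_pow, mul_pow, Real.sq_sqrt hA]
    linarith
  · have h1 : x ^ 2 ≤ 0 := h.trans (mul_nonpos_of_nonpos_of_nonneg hA.le (by positivity))
    have h2 : x = 0 := pow_eq_zero_iff two_ne_zero |>.1 (le_antisymm h1 (sq_nonneg _))
    rw [h2]
    positivity

theorem form_le_opNorm {X : Type*} [NormedAddCommGroup X] [NormedSpace ℝ X]
    (B : X →L[ℝ] X →L[ℝ] ℝ) {x : X} {r : ℝ} (hx : ‖x‖ ≤ r) : B x x ≤ ‖B‖ * r ^ 2 := by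
  refine ((Real.le_norm_self _).trans (B.le_opNorm₂ x x)).trans ?_
  rw [mul_assoc, ← sq]
  gcongr

/-- Triangle inequality; the 6 is the trace constant 3 times the factor 2 in the bound for u₀. -/
theorem initial_data_le {M E ε c d : ℝ} (hEε : E ≤ ε) (hM : 0 ≤ M)
    {u₀ ubar₀ pbar₀ : H1} {u₁ ubar₁ p₀ : L2}
    (hdata : ‖u₀ - ubar₀‖ + ‖u₁ - ubar₁‖ + ‖p₀ - pbar₀.fn - (d * u₀.rep 1) • profile c‖ ≤ M * E)
    (hpbar : ‖pbar₀‖ ≤ M * ε) (hbar : ‖ubar₀‖ + ‖ubar₁‖ ≤ M * E) :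
    ‖u₀‖ ≤ 2 * M * E ∧ ‖u₁‖ ≤ 2 * M * E ∧
      ‖p₀‖ ≤ (2 + 6 * |d| * ‖profile c‖) * M * ε := by
  set r : L2 := p₀ - pbar₀.fn - (d * u₀.rep 1) • profile c with hr
  have hu₀ : ‖u₀‖ ≤ 2 * M * E := by
    have h4 := norm_add_le (u₀ - ubar₀) ubar₀
    rw [sub_add_cancel] at h4
    linarith [norm_nonneg (u₁ - ubar₁), norm_nonneg ubar₁, norm_nonneg r]
  have hu₁ : ‖u₁‖ ≤ 2 * M * E := by
    have h4 := norm_add_le (u₁ - ubar₁) ubar₁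
    rw [sub_add_cancel] at h4
    linarith [norm_nonneg (u₀ - ubar₀), norm_nonneg ubar₀, norm_nonneg r]
  refine ⟨hu₀, hu₁, ?_⟩
  have h4 : ‖r‖ ≤ M * E := by
    linarith [norm_nonneg (u₀ - ubar₀), norm_nonneg (u₁ - ubar₁)]
  have h5 := norm_add₃_le (a := r) (b := pbar₀.fn) (c := (d * u₀.rep 1) • profile c)
  rw [show r + pbar₀.fn + (d * u₀.rep 1) • profile c = p₀ by rw [hr]; abel, norm_smul,
    Real.norm_eq_abs, abs_mul] at h5
  have h6 := pbar₀.norm_fn_le.trans hpbar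
  have h9 : M * E ≤ M * ε := by gcongr
  have h7 : |u₀.rep 1| ≤ 6 * M * ε := by linarith [u₀.abs_rep_one_le]
  have h8 : |d| * |u₀.rep 1| * ‖profile c‖ ≤ |d| * (6 * M * ε) * ‖profile c‖ := by gcongr
  linarith

/-- Both parts scale as ε³: the wave part as E², the heat part as ε · ε². -/
theorem fullForm_initial_le {μ ε M E C : ℝ} (hε : 0 ≤ ε) (hE : E ^ 2 = ε ^ 3) {g v p : L2}
    (hg : ‖g‖ ≤ 2 * M * E) (hv : ‖v‖ ≤ 2 * M * E) (hp : ‖p‖ ≤ C * M * ε) :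
    fullForm μ ε (g, v, p) (g, v, p) ≤ M ^ 2 * (4 * ‖waveForm μ‖ + C ^ 2) * E ^ 2 := by
  rw [fullForm_apply, real_inner_self_eq_norm_sq]
  have h4 : waveForm μ (g, v) (g, v) ≤ ‖waveForm μ‖ * (2 * M * E) ^ 2 :=
    form_le_opNorm _ (max_le hg hv)
  have h5 : ε * ‖p‖ ^ 2 ≤ ε * (C * M * ε) ^ 2 := by gcongr
  have h6 : ε * (C * M * ε) ^ 2 = C ^ 2 * M ^ 2 * E ^ 2 := by
    rw [hE]; ring
  dsimp only
  linarith

/-- The factor 4 and the summand C² are slack, so that one constant serves the coupled and the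
reduced system. -/
theorem waveForm_initial_le {μ M E : ℝ} (C : ℝ) {g v : L2} (hg : ‖g‖ ≤ M * E)
    (hv : ‖v‖ ≤ M * E) :
    waveForm μ (g, v) (g, v) ≤ M ^ 2 * (4 * ‖waveForm μ‖ + C ^ 2) * E ^ 2 := by
  have h4 : waveForm μ (g, v) (g, v) ≤ ‖waveForm μ‖ * (M * E) ^ 2 :=
    form_le_opNorm _ (max_le hg hv)
  have h5 : 0 ≤ C ^ 2 * (M ^ 2 * E ^ 2) := by positivity
  have h6 : 0 ≤ ‖waveForm μ‖ * (M ^ 2 * E ^ 2) :=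
    mul_nonneg (norm_nonneg (waveForm μ)) (by positivity)
  linarith

theorem exp_eq_sq (μ t : ℝ) : Real.exp (-(μ / 4 * t)) = Real.exp (-(μ / 8) * t) ^ 2 := by
  rw [← Real.exp_nat_mul]
  congr 1
  push_cast
  ring

theorem norm_wave_le {μ S E : ℝ} (hμ : 0 ≤ μ) (hE : 0 ≤ E) (x : L2 × L2) (t : ℝ)
    (hx : waveForm μ x x ≤ S * (Real.exp (-(μ / 8) * t) ^ 2 * E ^ 2)) :
    ‖x.1‖ ≤ √(Real.cosh μ / 2 * S) * Real.exp (-(μ / 8) * t) * E ∧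
      ‖x.2‖ ≤ √(Real.cosh μ / 2 * S) * Real.exp (-(μ / 8) * t) * E := by
  have hch := Real.cosh_pos μ
  have h4 := mul_le_mul_of_nonneg_left hx (show 0 ≤ Real.cosh μ / 2 by positivity)
  rw [← mul_assoc] at h4
  exact ⟨norm_le_of_sq_le_exp (Real.exp_pos _).le hE ((norm_fst_sq_le_waveForm hμ x).trans h4),
    norm_le_of_sq_le_exp (Real.exp_pos _).le hE ((norm_snd_sq_le_waveForm hμ x).trans h4)⟩

/-- The weight ε costs half a power: ε‖p‖² = O(ε³) only gives ‖p‖ = O(ε). -/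
theorem norm_heat_le {μ ε S E e : ℝ} (hμ : 0 ≤ μ) (hε : 0 < ε) (hE : E ^ 2 = ε ^ 3) (he : 0 ≤ e)
    {x : L2 × L2 × L2} (hx : fullForm μ ε x x ≤ S * (e ^ 2 * E ^ 2)) :
    ‖x.2.2‖ ≤ √S * e * ε := by
  refine norm_le_of_sq_le_exp he hε.le ?_
  have h5 := (heat_le_fullForm hμ x).trans hx
  rw [hE] at h5
  refine le_of_mul_le_mul_left (h5.trans_eq ?_) hε
  ring

/-- In the slow time the layer energy decays like e^{-t/ε}, which εμ ≤ 1 makes faster than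
e^{-μt/4}. -/
theorem norm_layer_le {μ ε c M t : ℝ} (hμ : 0 ≤ μ) (hc : 1 ≤ c) (hε : 0 < ε) (hεμ : ε * μ ≤ 1)
    (ht : 0 ≤ t) {p p₀ : H1} (hp₀ : ‖p₀‖ ≤ M * ε)
    (hp : layerForm c p p ≤ Real.exp (-(t / ε)) * layerForm c p₀ p₀) :
    ‖p.fn‖ ≤ √(2 * ((1 + 4 * c) * M ^ 2)) * Real.exp (-(μ / 8) * t) * ε := by
  refine norm_le_of_sq_le_exp (Real.exp_pos _).le hε.le ?_
  have h7 := norm_fn_sq_le_layerForm hc p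
  have h8 : Real.exp (-(t / ε)) ≤ Real.exp (-(μ / 8) * t) ^ 2 := by
    rw [← exp_eq_sq, Real.exp_le_exp, neg_le_neg_iff, le_div_iff₀ hε]
    nlinarith [mul_nonneg hμ ht, mul_le_mul_of_nonneg_right hεμ ht]
  have h9 : layerForm c p₀ p₀ ≤ (1 + 4 * c) * (M * ε) ^ 2 :=
    (layerForm_le (zero_le_one.trans hc) p₀).trans (by gcongr)
  have h10 : Real.exp (-(t / ε)) * layerForm c p₀ p₀
      ≤ Real.exp (-(μ / 8) * t) ^ 2 * ((1 + 4 * c) * (M * ε) ^ 2) :=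
    mul_le_mul h8 h9 (form_nonneg (by norm_num) (layerForm_coercive hc) _) (by positivity)
  linarith

theorem norm_profile_le (c d : ℝ) {g : L2} {r : ℝ} (hg : ‖g‖ ≤ r) :
    ‖(d * (primFun g).rep 1) • profile c‖ ≤ |d| * r * ‖profile c‖ := by
  have h7 := (primFun g).abs_rep_sub_le (x := 1) (by simp)
  rw [primFun_rep_zero, sub_zero, primFun_deriv] at h7
  rw [norm_smul, Real.norm_eq_abs, abs_mul]
  gcongr
  exact h7.trans hg

theorem norm_primFun_sub_add_le {g g' v v' : L2} {r : ℝ} (hg : ‖g‖ ≤ r) (hg' : ‖g'‖ ≤ r)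
    (hv : ‖v‖ ≤ r) (hv' : ‖v'‖ ≤ r) : ‖primFun g - primFun g'‖ + ‖v - v'‖ ≤ 6 * r := by
  have h1 := norm_sub_le (primFun g) (primFun g')
  have h2 := norm_sub_le v v'
  have h3 := norm_primFun_le g
  have h4 := norm_primFun_le g'
  linarith

theorem norm_sub_sub_le {F : Type*} [SeminormedAddCommGroup F] {x y z : F} {r s t : ℝ}
    (hx : ‖x‖ ≤ r) (hy : ‖y‖ ≤ s) (hz : ‖z‖ ≤ t) : ‖x - y - z‖ ≤ r + s + t := by
  have h1 := norm_sub_le (x - y) z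
  have h2 := norm_sub_le x y
  linarith

end HeatWave

theorem theorem3 (a b c d μ : ℝ)
    (hμ : 0 < μ) (hμa : μ ≤ muStar a)
    (hi : a ∈ Set.Icc eta⁻¹ eta \ {1})
    (hii : |b * d / c| ≤ 1)
    (hiii : Real.pi ^ 2 / 8 ≤ c)
    (hiv : 1 + 2 * (Real.sinh μ + 2 * Real.cosh μ) * b ^ 2 ≤ c)
    (hv : |d| ≤ 2 * √(μ * Real.exp (-μ)))
    (h1 : Real.pi ^ 2 / 4 ≤ c)
    (h2 : (Real.pi ^ 2 + 2) / 4 + Fmu μ * b ^ 2 ≤ c)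
    (h3 : |d| ≤ √(μ * Real.exp (-μ))) :
    ∃ εstar : ℝ, 0 < εstar ∧ ∀ M : ℝ, ∃ C : ℝ, ∀ ε : ℝ, 0 < ε → ε < εstar →
      ∀ (u₀ : H1) (u₁ p₀ : L2) (ubar₀ : H1) (ubar₁ : L2) (pbar₀ : H1),
        u₀.rep 0 = 0 → ubar₀.rep 0 = 0 →
        ‖u₀ - ubar₀‖ + ‖u₁ - ubar₁‖ + ‖p₀ - pbar₀.fn - (d * u₀.rep 1) • profile c‖
          ≤ M * ε ^ (3 / 2 : ℝ) →
        ‖pbar₀‖ ≤ M * ε →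
        ‖ubar₀‖ + ‖ubar₁‖ ≤ M * ε ^ (3 / 2 : ℝ) →
        ∃ (u : ℝ → H1) (v p : ℝ → L2) (ubar : ℝ → H1) (vbar : ℝ → L2) (pbar : ℝ → H1),
          -- `(u, v, p)`, with `v = u_t`, is the mild solution of the coupled system
          IsUniqueMildSolution (fullOp a b c d ε) (u₀, u₁, p₀) (fun t => (u t, v t, p t)) ∧
          (∀ t : ℝ, 0 ≤ t → HasDerivWithinAt (fun s => (u s).fn) (v t) (Set.Ici 0) t) ∧
          -- `(ubar, vbar)`, with `vbar = ubar_t`, is the mild solution of the reduced system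
          IsUniqueMildSolution (reducedOp a b c d) (ubar₀, ubar₁) (fun t => (ubar t, vbar t)) ∧
          (∀ t : ℝ, 0 ≤ t → HasDerivWithinAt (fun s => (ubar s).fn) (vbar t) (Set.Ici 0) t) ∧
          -- `pbar` is the mild solution of the boundary-layer system, continuous into `H¹`
          IsUniqueMildSolution (layerOp c) pbar₀.fn (fun τ => (pbar τ).fn) ∧
          ContinuousOn pbar (Set.Ici 0) ∧
          -- the two estimates
          (∀ t : ℝ, 0 ≤ t →
            ‖u t - ubar t‖ + ‖v t - vbar t‖
              ≤ C * Real.exp (-(μ / 8) * t) * ε ^ (3 / 2 : ℝ)) ∧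
          (∀ t : ℝ, 0 ≤ t →
            ‖p t - (pbar (t / ε)).fn - (d * (ubar t).rep 1) • profile c‖
              ≤ C * Real.exp (-(μ / 8) * t) * ε) := by
  have ha := boundary_condition hμa hi
  have hb := cosh_mul_sq_le hμ h2
  have hd := sq_le_of_abs_le_sqrt hμ h3
  have hc1 : 1 ≤ c := by
    have : 0 ≤ Real.cosh μ * b ^ 2 := by have := Real.cosh_pos μ; positivity
    linarith
  set K : ℝ := ‖waveForm μ‖
  set L : ℝ := 1 + 4 * c with hL
  set N : ℝ := ‖profile c‖ with hN
  -- The bound 1 gives ε^(3/2) ≤ ε; the bound 1/μ gives εμ ≤ 1.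
  refine ⟨min 1 μ⁻¹, lt_min one_pos (inv_pos.2 hμ), fun M => ?_⟩
  -- S bounds both initial wave-type energies divided by ε³.
  set S : ℝ := M ^ 2 * (4 * K + (2 + 6 * |d| * N) ^ 2) with hS
  set A : ℝ := √(Real.cosh μ / 2 * S) with hA
  have hN0 : 0 ≤ N := norm_nonneg _
  have hK0 : 0 ≤ K := norm_nonneg (waveForm μ)
  have hL0 : 0 ≤ L := by linarith
  -- The first summand serves the wave estimate, the bracket the heat estimate.
  refine ⟨6 * A + (√S + √(2 * (L * M ^ 2)) + |d| * A * N), fun ε hε0 hε u₀ u₁ p₀ ubar₀ ubar₁ pbar₀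
    hu hubar hdata hpbar hbar => ?_⟩
  have hε1 : ε ≤ 1 := (hε.trans_le (min_le_left _ _)).le
  have hεμ : ε * μ ≤ 1 := by
    have := (hε.trans_le (min_le_right _ _)).le
    rwa [← one_div, le_div_iff₀ hμ] at this
  obtain ⟨E, hE⟩ : ∃ E : ℝ, E = ε ^ (3 / 2 : ℝ) := ⟨_, rfl⟩
  have hE0 : 0 < E := hE ▸ Real.rpow_pos_of_pos hε0 _
  have hE2 : E ^ 2 = ε ^ 3 := by
    rw [hE, ← Real.rpow_natCast, ← Real.rpow_mul hε0.le, ← Real.rpow_natCast]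
    norm_num
  have hEε : E ≤ ε := by
    refine abs_le_of_sq_le_sq' ?_ hε0.le |>.2
    rw [hE2]
    exact pow_le_pow_of_le_one hε0.le hε1 (by norm_num)
  rw [← hE] at hdata hbar ⊢
  -- The sign of M is not given, but the bound on the layer data forces it.
  have hM : 0 ≤ M :=
    nonneg_of_mul_nonneg_left ((norm_nonneg _).trans hpbar) hε0
  obtain ⟨hu₀, hu₁, hp₀⟩ := initial_data_le hEε hM hdata hpbar hbar
  have hfull0 : fullForm μ ε (u₀.deriv, u₁, p₀) (u₀.deriv, u₁, p₀) ≤ S * E ^ 2 :=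
    fullForm_initial_le hε0.le hE2 (u₀.norm_deriv_le.trans hu₀) hu₁ hp₀
  have hbar0 : waveForm μ (ubar₀.deriv, ubar₁) (ubar₀.deriv, ubar₁) ≤ S * E ^ 2 :=
    waveForm_initial_le _ (ubar₀.norm_deriv_le.trans (by linarith [norm_nonneg ubar₁]))
      (by linarith [norm_nonneg ubar₀])
  obtain ⟨Y, hYc, hYm, hYd⟩ := exists_full_solution hμ ha hb hd hε0 hεμ hu u₁ p₀
  obtain ⟨Z, hZc, hZm, hZd⟩ := exists_reduced_solution hμ ha hb hd hubar ubar₁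
  obtain ⟨P, hPc, hPm, hPd⟩ := exists_layer_solution hc1 pbar₀
  have hY : ∀ t, 0 ≤ t → fullForm μ ε (Y t) (Y t)
      ≤ S * (Real.exp (-(μ / 8) * t) ^ 2 * E ^ 2) := by
    intro t ht
    have h4 := mul_le_mul_of_nonneg_left hfull0 (Real.exp_pos (-(μ / 4 * t))).le
    have h5 := (hYd t ht).trans h4
    rw [exp_eq_sq] at h5
    linarith only [h5]
  have hZ : ∀ t, 0 ≤ t → waveForm μ (Z t) (Z t)
      ≤ S * (Real.exp (-(μ / 8) * t) ^ 2 * E ^ 2) := by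
    intro t ht
    have h4 := mul_le_mul_of_nonneg_left hbar0 (Real.exp_pos (-(μ / 4 * t))).le
    have h5 := (hZd t ht).trans h4
    rw [exp_eq_sq] at h5
    linarith only [h5]
  have hYw := fun t (ht : 0 ≤ t) => norm_wave_le hμ.le hE0.le ((Y t).1, (Y t).2.1) t
    ((waveForm_le_fullForm hε0.le (Y t)).trans (hY t ht))
  have hZw := fun t (ht : 0 ≤ t) => norm_wave_le hμ.le hE0.le (Z t) t (hZ t ht)
  have hA0 : 0 ≤ A := Real.sqrt_nonneg _
  have hG1 : 0 ≤ 6 * A := by positivity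
  have hG2 : 0 ≤ √S + √(2 * (L * M ^ 2)) + |d| * A * N := by positivity
  refine ⟨fun t => primFun (Y t).1, fun t => (Y t).2.1, fun t => (Y t).2.2,
    fun t => primFun (Z t).1, fun t => (Z t).2, P, hYm, fun t ht => ?_, hZm, fun t ht => ?_, hPm,
    hPc.continuousOn, fun t ht => ?_, fun t ht => ?_⟩
  · exact hYm.1.hasDerivWithinAt_fn (fullLift.continuous.comp hYc)
      (ContinuousLinearMap.fst ℝ H1 (L2 × L2))
      (ContinuousLinearMap.fst ℝ L2 L2 ∘L ContinuousLinearMap.snd ℝ H1 (L2 × L2))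
      (by rintro y z ⟨w, q, ux, px, h, -, -, -, -, -, -, -, -, rfl⟩; exact h) ht
  · exact hZm.1.hasDerivWithinAt_fn (reducedLift.continuous.comp hZc)
      (ContinuousLinearMap.fst ℝ H1 L2) (ContinuousLinearMap.snd ℝ H1 L2)
      (by rintro y z ⟨w, ux, h, -, -, -, -, rfl⟩; exact h) ht
  · obtain ⟨h4, h5⟩ := hYw t ht
    obtain ⟨h6, h7⟩ := hZw t ht
    refine (norm_primFun_sub_add_le h4 h6 h5 h7).trans ?_
    have h12 : 0 ≤ (√S + √(2 * (L * M ^ 2)) + |d| * A * N)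
        * (Real.exp (-(μ / 8) * t) * E) := by positivity
    linarith only [h12]
  · have he := Real.exp_pos (-(μ / 8) * t)
    have h4 : ‖(Y t).2.2‖ ≤ √S * Real.exp (-(μ / 8) * t) * ε :=
      norm_heat_le hμ.le hε0 hE2 he.le (hY t ht)
    have h5 : ‖(P (t / ε)).fn‖ ≤ √(2 * (L * M ^ 2)) * Real.exp (-(μ / 8) * t) * ε :=
      norm_layer_le hμ.le hc1 hε0 hεμ ht hpbar (hPd (t / ε) (div_nonneg ht hε0.le))
    have h6 : ‖(d * (primFun (Z t).1).rep 1) • profile c‖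
        ≤ |d| * A * N * Real.exp (-(μ / 8) * t) * ε := by
      refine (norm_profile_le c d ((hZw t ht).1)).trans ?_
      have h7 : |d| * A * N * Real.exp (-(μ / 8) * t) * E
        ≤ |d| * A * N * Real.exp (-(μ / 8) * t) * ε := by gcongr
      linarith only [h7]
    refine (norm_sub_sub_le h4 h5 h6).trans ?_
    have h9 : 0 ≤ 6 * A * (Real.exp (-(μ / 8) * t) * ε) := by positivity
    linarith only [h9]
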